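/- Let $K$ be a global function field, that is, a finite extension of $\mathbb{F}_q(x)$ for a finite field $\mathbb{F}_q$, of characteristic $p \neq 3$. Let $L/K$ be an impurely cubic extension, that is, $[L:K]=3$ and no generator of $L/K$ has a minimal polynomial of the form $X^3-b$ with $b \in K$. Let $y$ be a generator of $L/K$ with minimal polynomial $X^3-3X-a$, $a\in K$. Let $\mathfrak{p}$ be a place of $K$ with normalized discrete valuation $v_{\mathfrak{p}}$. Then the following hold. 1. $\mathfrak{p}$ is fully ramified in $L$ (some place $\mathfrak{P}$ of $L$ above $\mathfrak{p}$ has $e(\mathfrak{P}|\mathfrak{p})=3$) if and only if $v_{\mathfrak{p}}(a)<0$ and $\gcd(v_{\mathfrak{p}}(a),3)=1$. 2. $\mathfrak{p}$ is partially ramified in $L$ (some place $\mathfrak{P}$ of $L$ above $\mathfrak{p}$ has $e(\mathfrak{P}|\mathfrak{p})=2$) if and only if $a\equiv 2$ or $a \equiv -2 \pmod{\mathfrak{p}}$ (in particular $v_{\mathfrak{p}}(a)\geq 0$) and $\mathfrak{p}$ ramifies in $K(r)$, where $r$ is any root, in an algebraic closure of $K$, of the quadratic resolvent $X^2+3aX+(9a^2-27)$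 of $X^3-3X-a$. Explicitly: (a) if $p\neq 2$, then $\mathfrak{p}$ is partially ramified in $L$ if and only if $a\equiv\pm 2 \pmod{\mathfrak{p}}$ and $\gcd(v_{\mathfrak{p}}(a^2-4),2)=1$; (b) if $p=2$, then $\mathfrak{p}$ is partially ramified in $L$ if and only if $a\equiv \pm 2 \pmod{\mathfrak{p}}$ (that is, $a \equiv 0$) and there exists $w\in K$ such that $v_{\mathfrak{p}}\left(\frac1a+1+w^2-w\right)<0$ and $\gcd\left(v_{\mathfrak{p}}\left(\frac1a+1+w^2-w\right),2\right)=1$. -/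

import Mathlib

open Polynomial

/-- A place of a global function field `K`, given by its normalized discrete valuation
`K → ℤ ∪ {∞}`, written multiplicatively: `|z| = exp (-v(z))`, with `|0| = 0`. Every valuation of
such a field is trivial on the constants, as these form a finite field. -/
@[ext]
structure Place (K : Type*) [Field K] where
  valuation : Valuation K (WithZero (Multiplicative ℤ))
  surjective : Function.Surjective valuation

namespace Place

/-- The order `v_𝔭(z)` of a nonzero element `z` at the place `𝔭`. (At `z = 0`, where the order is
infinite, this function takes the value `0`.) -/
noncomputable def ord {K : Type*} [Field K] (𝔭 : Place K) (z : K) : ℤ :=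
  -WithZero.log (𝔭.valuation z)

/-- `a ≡ b mod 𝔭`: both elements are integral at `𝔭`, and they have the same image in the
residue field of `𝔭`. -/
def ModEq {K : Type*} [Field K] (𝔭 : Place K) (a b : K) : Prop :=
  𝔭.valuation a ≤ 1 ∧ 𝔭.valuation b ≤ 1 ∧ 𝔭.valuation (a - b) < 1

/-- The place `𝔓` of `L` lies above the place `𝔭` of `K` with ramification index
`e(𝔓 | 𝔭) = e`: `e` is the positive integer such that `v_𝔓(z) = e v_𝔭(z)` for all `z` in `K`. -/
def HasRamificationIndex {K L : Type*} [Field K] [Field L] [Algebra K L]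
    (𝔓 : Place L) (𝔭 : Place K) (e : ℕ) : Prop :=
  0 < e ∧ ∀ z : K, z ≠ 0 → 𝔓.ord (algebraMap K L z) = (e : ℤ) * 𝔭.ord z

/-- Some place of `L` above `𝔭` has ramification index greater than `1`. -/
def IsRamifiedIn {K : Type*} [Field K] (𝔭 : Place K) (L : Type*) [Field L] [Algebra K L] : Prop :=
  ∃ (𝔓 : Place L) (e : ℕ), 𝔓.HasRamificationIndex 𝔭 e ∧ 1 < e

/-- Some place of `L` above `𝔭` has ramification index `[L : K]`. -/
def IsFullyRamifiedIn {K : Type*} [Field K] (𝔭 : Place K) (L : Type*) [Field L] [Algebra K L] :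
    Prop :=
  ∃ 𝔓 : Place L, 𝔓.HasRamificationIndex 𝔭 (Module.finrank K L)

/-- Some place of `L` above `𝔭` has ramification index `2`; for a cubic extension `L / K` these are
the ramified places that are not fully ramified. -/
def IsPartiallyRamifiedIn {K : Type*} [Field K] (𝔭 : Place K) (L : Type*) [Field L]
    [Algebra K L] : Prop :=
  ∃ 𝔓 : Place L, 𝔓.HasRamificationIndex 𝔭 2

end Place

/-- `y` is a generator of `L / K` with minimal polynomial `X³ - b` for some `b` in `K`. -/
def IsPurelyCubicGenerator (K : Type*) {L : Type*} [Field K] [Field L] [Algebra K L] (y : L) :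
    Prop :=
  IntermediateField.adjoin K {y} = ⊤ ∧ ∃ b : K, minpoly K y = X ^ 3 - C b

/-- `L / K` is a cubic extension without a purely cubic generator. -/
def IsImpurelyCubic (K L : Type*) [Field K] [Field L] [Algebra K L] : Prop :=
  Module.finrank K L = 3 ∧ ¬ ∃ y : L, IsPurelyCubicGenerator K y

/-- The quadratic resolvent `X² + 3 a X + (9 a² - 27)` of the cubic `X³ - 3 X - a`. -/
noncomputable def quadraticResolvent {K : Type*} [Field K] (a : K) : K[X] :=
  X ^ 2 + C (3 * a) * X + C (-27 + 9 * a ^ 2)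

/-! Ramification indices are read off from explicit equations. Divisibility comes from comparing
orders: if a power `y ^ n`, with `n` equal to 2 or 3, has the same order at 𝔓 as an element of `K`,
then `n` divides `e` times the order of that element at 𝔭, hence `e` when `n` does not divide that
order. Conversely, `HasRamificationIndex.eq_one_of_simple_root` gives `e = 1` as soon as an integral
generator is a simple root modulo 𝔓 of a polynomial over the valuation ring, monic or not. With `e ≤
[L : K]` and the existence of places above 𝔭, these two tools decide every case.

Let `y³ - 3y = a`. At a pole of `a` the term `y³` dominates: an order prime to 3 forces `3 ∣ e`, and
an order divisible by 3 allows rescaling `y` to a simple root. If `a` is integral, the discriminant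
is `a² - 4` up to the unit -27, so only `a ≡ ±2` can ramify, and `y ↦ -y` reduces this to `a ≡ 2`.
Then `t = y + 1` satisfies `t²(3 - t) = c` with `c = 2 - a`, which modulo 𝔭 has the simple root 3
and the double root 0. Ramification can occur only where `t` vanishes, and there `2 ord t = e ord
c`. For `p ≠ 2` the parity of `ord c` decides. For `p = 2`, `1/t` satisfies the Artin–Schreier
equation `X² + X = 1/c + 1` up to the integral error `t/(1 + t)`; since the residue field is
perfect, the right side can be reduced to an integral element or to one with a pole of odd order.

The resolvent generates the extension given by a square root of `-27(a² - 4)`, or by `X² + X = 1/a +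
1` in characteristic 2, so its ramification obeys the same criterion. -/

namespace Place

open WithZero

/-! ### Arithmetic of the order function. -/

section Basic

variable {K : Type*} [Field K] (𝔭 : Place K)

theorem valuation_ne_zero {z : K} (hz : z ≠ 0) : 𝔭.valuation z ≠ 0 :=
  (Valuation.ne_zero_iff _).2 hz

theorem valuation_eq_exp {z : K} (hz : z ≠ 0) : 𝔭.valuation z = exp (-𝔭.ord z) := by
  rw [ord, neg_neg, exp_log (𝔭.valuation_ne_zero hz)]

theorem ord_eq_of_valuation_eq {z : K} {n : ℤ} (h : 𝔭.valuation z = exp (-n)) : 𝔭.ord z = n := by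
  rw [ord, h, log_exp, neg_neg]

theorem ord_mul {x y : K} (hx : x ≠ 0) (hy : y ≠ 0) : 𝔭.ord (x * y) = 𝔭.ord x + 𝔭.ord y := by
  simp only [ord, map_mul]
  rw [log_mul (𝔭.valuation_ne_zero hx) (𝔭.valuation_ne_zero hy), neg_add]

theorem ord_pow (x : K) (n : ℕ) : 𝔭.ord (x ^ n) = n * 𝔭.ord x := by
  simp [ord, log_pow]

theorem ord_zpow (x : K) (n : ℤ) : 𝔭.ord (x ^ n) = n * 𝔭.ord x := by
  simp [ord, log_zpow]

theorem ord_inv (x : K) : 𝔭.ord x⁻¹ = -𝔭.ord x := by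
  simp [ord, log_inv]

theorem valuation_lt_one_iff {z : K} (hz : z ≠ 0) : 𝔭.valuation z < 1 ↔ 0 < 𝔭.ord z := by
  rw [valuation_eq_exp 𝔭 hz, ← exp_zero, exp_lt_exp]; omega

theorem one_lt_valuation_iff {z : K} (hz : z ≠ 0) : 1 < 𝔭.valuation z ↔ 𝔭.ord z < 0 := by
  rw [valuation_eq_exp 𝔭 hz, ← exp_zero, exp_lt_exp]; omega

theorem valuation_le_one_iff {z : K} (hz : z ≠ 0) : 𝔭.valuation z ≤ 1 ↔ 0 ≤ 𝔭.ord z := by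
  rw [valuation_eq_exp 𝔭 hz, ← exp_zero, exp_le_exp]; omega

theorem valuation_eq_one_iff {z : K} (hz : z ≠ 0) : 𝔭.valuation z = 1 ↔ 𝔭.ord z = 0 := by
  rw [valuation_eq_exp 𝔭 hz, ← exp_zero, exp_inj]; omega

theorem ord_eq_zero {z : K} (hz : 𝔭.valuation z = 1) : 𝔭.ord z = 0 := by
  simp [ord, hz]

theorem ord_eq_of_valuation_eq_valuation {x y : K} (h : 𝔭.valuation x = 𝔭.valuation y) :
    𝔭.ord x = 𝔭.ord y := by
  rw [ord, ord, h]

theorem exists_uniformizer : ∃ π : K, π ≠ 0 ∧ 𝔭.valuation π = exp (-1 : ℤ) ∧ 𝔭.ord π = 1 := by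
  obtain ⟨π, hπ⟩ := 𝔭.surjective (exp (-1 : ℤ))
  refine ⟨π, ?_, hπ, 𝔭.ord_eq_of_valuation_eq hπ⟩
  rintro rfl
  exact exp_ne_zero (hπ.symm.trans (map_zero _))

theorem exists_ord_eq (n : ℤ) : ∃ z : K, z ≠ 0 ∧ 𝔭.ord z = n := by
  obtain ⟨z, hz⟩ := 𝔭.surjective (exp (-n))
  refine ⟨z, ?_, 𝔭.ord_eq_of_valuation_eq hz⟩
  rintro rfl
  exact exp_ne_zero (hz.symm.trans (map_zero _))

end Basic

/-! ### Ramification indices: degree bound, simple roots, existence of places. -/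

namespace HasRamificationIndex

variable {K L : Type*} [Field K] [Field L] [Algebra K L] {𝔓 : Place L} {𝔭 : Place K} {e : ℕ}

theorem valuation_algebraMap (h : 𝔓.HasRamificationIndex 𝔭 e) (z : K) :
    𝔓.valuation (algebraMap K L z) = 𝔭.valuation z ^ e := by
  rcases eq_or_ne z 0 with rfl | hz
  · simp [h.1.ne']
  rw [valuation_eq_exp _ (by simpa using hz), valuation_eq_exp _ hz, h.2 z hz, ← exp_nsmul]
  simp

theorem valuation_lt_one (h : 𝔓.HasRamificationIndex 𝔭 e) {z : K} (hz : 𝔭.valuation z < 1) :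
    𝔓.valuation (algebraMap K L z) < 1 := by
  rw [h.valuation_algebraMap]; exact pow_lt_one₀ zero_le hz h.1.ne'

theorem valuation_le_one (h : 𝔓.HasRamificationIndex 𝔭 e) {z : K} (hz : 𝔭.valuation z ≤ 1) :
    𝔓.valuation (algebraMap K L z) ≤ 1 := by
  rw [h.valuation_algebraMap]; exact pow_le_one₀ zero_le hz

theorem valuation_eq_one (h : 𝔓.HasRamificationIndex 𝔭 e) {z : K} (hz : 𝔭.valuation z = 1) :
    𝔓.valuation (algebraMap K L z) = 1 := by
  rw [h.valuation_algebraMap, hz, one_pow]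

/-- The powers `1, ϖ, …, ϖ ^ (e - 1)` of a uniformizer at 𝔓 are independent over `K`: the nonzero
terms of a linear combination have orders that are distinct modulo `e`, so one term dominates and
the sum cannot vanish. -/
theorem le_finrank [FiniteDimensional K L] (h : 𝔓.HasRamificationIndex 𝔭 e) :
    e ≤ Module.finrank K L := by
  classical
  obtain ⟨ϖ, hϖ, -, h1⟩ := 𝔓.exists_uniformizer
  have key : LinearIndependent K (fun i : Fin e => ϖ ^ (i : ℕ)) := by
    rw [Fintype.linearIndependent_iff]
    by_contra! hcon
    obtain ⟨g, hg, i₀, hi₀⟩ := hcon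
    have hord : ∀ i, g i ≠ 0 → 𝔓.ord (g i • ϖ ^ (i : ℕ)) = e * 𝔭.ord (g i) + i := by
      intro i hi
      rw [Algebra.smul_def, ord_mul _ (by simpa using hi) (pow_ne_zero _ hϖ), h.2 _ hi, ord_pow,
        h1, mul_one]
    have hne : ∀ i, g i ≠ 0 → g i • ϖ ^ (i : ℕ) ≠ 0 := fun i hi =>
      smul_ne_zero hi (pow_ne_zero _ hϖ)
    obtain ⟨j, -, hj⟩ := Finset.exists_max_image Finset.univ
      (fun i : Fin e => 𝔓.valuation (g i • ϖ ^ (i : ℕ))) ⟨i₀, Finset.mem_univ _⟩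
    have hvj : 𝔓.valuation (g j • ϖ ^ (j : ℕ)) ≠ 0 := by
      intro h0
      have := hj i₀ (Finset.mem_univ _)
      rw [h0, le_zero_iff] at this
      exact 𝔓.valuation_ne_zero (hne i₀ hi₀) this
    have hgj : g j ≠ 0 := by
      intro h0
      simp [h0] at hvj
    have := 𝔓.valuation.map_sum_eq_of_lt (f := fun i : Fin e => g i • ϖ ^ (i : ℕ))
      (Finset.mem_univ j) (fun i hi => by
        have hij : i ≠ j := by simpa using hi
        refine lt_of_le_of_ne (hj i (Finset.mem_univ _)) fun heq => ?_
        have hgi : g i ≠ 0 := by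
          intro h0
          rw [← heq] at hvj
          simp [h0] at hvj
        have h2 := ord_eq_of_valuation_eq_valuation 𝔓 heq
        rw [hord i hgi, hord j hgj] at h2
        have h3 : ((i : ℕ) : ℤ) ≡ ((j : ℕ) : ℤ) [ZMOD e] := by
          rw [Int.modEq_iff_dvd]
          exact ⟨𝔭.ord (g i) - 𝔭.ord (g j), by linear_combination -h2⟩
        rw [Int.natCast_modEq_iff] at h3
        exact hij (Fin.ext (Nat.ModEq.eq_of_lt_of_lt h3 i.2 j.2)))
    rw [hg, map_zero] at this
    exact hvj this.symm
  simpa using key.fintype_card_le_finrank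

end HasRamificationIndex

/-- A place has ramification index one if the extension is generated by an integral element that
is a simple root, modulo the place, of a polynomial with integral coefficients. -/
theorem HasRamificationIndex.eq_one_of_simple_root {K L : Type*} [Field K] [Field L] [Algebra K L]
    {𝔓 : Place L} {𝔭 : Place K} {e : ℕ} (h : 𝔓.HasRamificationIndex 𝔭 e) {s : L}
    (hs : Algebra.adjoin K {s} = ⊤) (hs1 : 𝔓.valuation s ≤ 1) (F : K[X])
    (hF : ∀ i, 𝔭.valuation (F.coeff i) ≤ 1) (hF0 : aeval s F = 0)
    (hF' : 𝔓.valuation (aeval s (derivative F)) = 1) : e = 1 := by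
  let O := 𝔭.valuation.valuationSubring
  let O' := 𝔓.valuation.valuationSubring
  let φ : O →+* O' := ((algebraMap K L).comp O.subtype).codRestrict O'.toSubring
    fun x => h.valuation_le_one x.2
  have hφ : ∀ x : O, ((φ x : O') : L) = algebraMap K L x := fun _ => rfl
  have unit_iff' : ∀ x : O', IsUnit x ↔ 𝔓.valuation x = 1 := fun x =>
    (Valuation.integer.integers 𝔓.valuation).isUnit_iff_valuation_eq_one (x := x)
  have unit_iff : ∀ x : O, IsUnit x ↔ 𝔭.valuation x = 1 := fun x =>
    (Valuation.integer.integers 𝔭.valuation).isUnit_iff_valuation_eq_one (x := x)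
  have : IsLocalHom φ := ⟨fun x hx => by
    rw [unit_iff', hφ, h.valuation_algebraMap] at hx
    rw [unit_iff]
    exact (pow_eq_one_iff_of_nonneg zero_le h.1.ne').1 hx⟩
  let : Algebra (IsLocalRing.ResidueField O) (IsLocalRing.ResidueField O') :=
    (IsLocalRing.ResidueField.map φ).toAlgebra
  have res_iff : ∀ x : O, IsLocalRing.residue O x = 0 ↔ 𝔭.valuation x < 1 := fun x => by
    rw [IsLocalRing.residue_eq_zero_iff, IsLocalRing.mem_maximalIdeal, mem_nonunits_iff, unit_iff]
    exact ⟨lt_of_le_of_ne x.2, ne_of_lt⟩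
  have res_iff' : ∀ x : O', IsLocalRing.residue O' x = 0 ↔ 𝔓.valuation x < 1 := fun x => by
    rw [IsLocalRing.residue_eq_zero_iff, IsLocalRing.mem_maximalIdeal, mem_nonunits_iff, unit_iff']
    exact ⟨lt_of_le_of_ne x.2, ne_of_lt⟩
  let σ : O' := ⟨s, hs1⟩
  have hres : ∀ q : O[X], IsLocalRing.residue O' (q.eval₂ φ σ) =
      aeval (IsLocalRing.residue O' σ) (q.map (IsLocalRing.residue O)) := fun q => by
    rw [Polynomial.hom_eval₂, aeval_def, eval₂_map]
    rfl
  have hev : ∀ q : O[X], ((q.eval₂ φ σ : O') : L) = aeval s (q.map O.subtype) := fun q => by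
    rw [aeval_def, eval₂_map]
    exact Polynomial.hom_eval₂ q φ O'.subtype σ
  obtain ⟨G, rfl⟩ : ∃ G : O[X], G.map O.subtype = F := by
    have : F ∈ Polynomial.lifts O.subtype := by
      rw [Polynomial.lifts_iff_coeff_lifts]
      exact fun i => ⟨⟨F.coeff i, hF i⟩, rfl⟩
    simpa [Polynomial.mem_lifts] using this
  obtain ⟨π, hπ, hπ1, hπ2⟩ := 𝔭.exists_uniformizer
  have hπO : 𝔭.valuation π ≤ 1 := by rw [hπ1, ← exp_zero, exp_le_exp]; omega
  have hG0 : G.eval₂ φ σ = 0 := Subtype.ext (by rw [hev, hF0]; rfl)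
  set κ := IsLocalRing.ResidueField O
  set sb := IsLocalRing.residue O' σ
  have hGs : aeval sb (G.map (IsLocalRing.residue O)) = 0 := by rw [← hres, hG0, map_zero]
  have hG' : aeval sb (derivative (G.map (IsLocalRing.residue O))) ≠ 0 := by
    rw [derivative_map, ← hres, Ne, res_iff', hev, ← derivative_map, hF']
    exact lt_irrefl _
  -- The reduction of `G` is the minimal polynomial of `sb` times `kb`. Simplicity of the root gives
  -- `kb(sb) ≠ 0`, so a lift `k` of `kb` takes a unit value at `s`.
  obtain ⟨kb, hkb⟩ := minpoly.dvd κ sb hGs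
  have hkb0 : aeval sb kb ≠ 0 := fun h0 => hG' <| by
    rw [hkb, derivative_mul, map_add, map_mul, map_mul, minpoly.aeval, h0, mul_zero, zero_mul,
      add_zero]
  obtain ⟨k, rfl⟩ := Polynomial.map_surjective _ IsLocalRing.residue_surjective kb
  have hk1 : 𝔓.valuation (k.eval₂ φ σ : O') = 1 := by
    rw [← hres, Ne, res_iff'] at hkb0
    exact le_antisymm (k.eval₂ φ σ : O').2 (not_lt.1 hkb0)
  -- If `q(s)` has positive order, the minimal polynomial of `sb` divides the reduction of `q`, so
  -- `q * k - G * l` vanishes modulo `π` for some `l`. Hence `q(s) k(s) = π m(s)`, and `m(s)` has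
  -- order smaller by exactly `e`.
  have hdvd : ∀ n : ℕ, ∀ q : O[X], 𝔓.valuation (q.eval₂ φ σ : O') = exp (-(n : ℤ)) → e ∣ n := by
    intro n
    induction n using Nat.strong_induction_on with
    | _ n ih =>
      intro q hq
      rcases Nat.eq_zero_or_pos n with rfl | hn
      · exact dvd_zero e
      have hq0 : aeval sb (q.map (IsLocalRing.residue O)) = 0 := by
        rw [← hres, res_iff', hq, ← exp_zero, exp_lt_exp]; omega
      obtain ⟨l, hl⟩ := minpoly.dvd κ sb hq0
      obtain ⟨l, rfl⟩ := Polynomial.map_surjective _ IsLocalRing.residue_surjective l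
      have hm : C (⟨π, hπO⟩ : O) ∣ q * k - G * l := by
        rw [C_dvd_iff_dvd_coeff]
        intro i
        have h0 : IsLocalRing.residue O ((q * k - G * l).coeff i) = 0 := by
          rw [← coeff_map, Polynomial.map_sub, Polynomial.map_mul, Polynomial.map_mul, hl, hkb]
          ring_nf
          simp
        rw [res_iff] at h0
        generalize (q * k - G * l).coeff i = c at h0
        have hc : 𝔭.valuation (π⁻¹ * c) ≤ 1 := by
          rcases eq_or_ne (c : K) 0 with hc0 | hc0
          · simp [hc0]
          rw [valuation_lt_one_iff _ hc0] at h0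
          rw [valuation_le_one_iff _ (mul_ne_zero (inv_ne_zero hπ) hc0),
            ord_mul _ (inv_ne_zero hπ) hc0, ord_inv, hπ2]
          omega
        exact ⟨⟨π⁻¹ * c, hc⟩, Subtype.ext (by simp [hπ])⟩
      obtain ⟨m, hm⟩ := hm
      have h1 : q.eval₂ φ σ * k.eval₂ φ σ = φ ⟨π, hπO⟩ * m.eval₂ φ σ := by
        have := congrArg (eval₂ φ σ) hm
        rwa [eval₂_sub, eval₂_mul, eval₂_mul, eval₂_mul, eval₂_C, hG0, zero_mul, sub_zero] at this
      have h2 := congrArg (fun x : O' => 𝔓.valuation x) h1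
      have h3 : exp (-(n : ℤ)) = exp (-(e : ℤ)) * 𝔓.valuation (m.eval₂ φ σ : O') := by
        simpa [hq, hk1, hφ, h.valuation_algebraMap, hπ1, ← exp_nsmul] using h2
      have hm0 : ((m.eval₂ φ σ : O') : L) ≠ 0 := by
        intro h0
        rw [h0, map_zero, mul_zero] at h3
        exact exp_ne_zero h3
      have hm1 := (m.eval₂ φ σ : O').2
      change 𝔓.valuation (m.eval₂ φ σ : O') ≤ 1 at hm1
      rw [valuation_le_one_iff _ hm0] at hm1
      rw [valuation_eq_exp _ hm0, ← exp_add, exp_inj] at h3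
      obtain ⟨j, hj⟩ := Int.eq_ofNat_of_zero_le hm1
      have hnj : n = e + j := by omega
      have := ih j (by have := h.1; omega) m (by rw [valuation_eq_exp _ hm0, hj])
      rw [hnj]
      exact dvd_add dvd_rfl this
  obtain ⟨ϖ, hϖ, hϖ1, hϖ2⟩ := 𝔓.exists_uniformizer
  -- A uniformizer at 𝔓 is a polynomial in `s` over `K`. Clearing denominators by `b` gives an
  -- integral polynomial whose value has order `e * j + 1`, so `e ∣ 1`.
  have hmem : ϖ ∈ Algebra.adjoin K {s} := hs ▸ Algebra.mem_top
  rw [Algebra.adjoin_singleton_eq_range_aeval] at hmem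
  obtain ⟨P, hP⟩ := hmem
  obtain ⟨b, hbm, hb⟩ := IsLocalization.integerNormalization_spec (nonZeroDivisors O) P
  set q := IsLocalization.integerNormalization (nonZeroDivisors O) P
  have hqP : q.map O.subtype = C ((b : O) : K) * P := by
    rw [← smul_eq_C_mul]
    exact hb
  have hb0 : ((b : O) : K) ≠ 0 := by
    simpa using nonZeroDivisors.ne_zero hbm
  have hval : ((q.eval₂ φ σ : O') : L) = algebraMap K L ((b : O) : K) * ϖ := by
    rw [hev, hqP, map_mul, aeval_C, ← hP]; rfl
  have hb1 := (b : O).2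
  change 𝔭.valuation ((b : O) : K) ≤ 1 at hb1
  rw [valuation_le_one_iff _ hb0] at hb1
  obtain ⟨j, hj⟩ := Int.eq_ofNat_of_zero_le hb1
  have := hdvd (e * j + 1) q (by
    rw [hval, map_mul, hϖ1, h.valuation_algebraMap, valuation_eq_exp _ hb0, hj, ← exp_nsmul,
      ← exp_add]
    congr 1
    push_cast
    simp
    ring)
  rwa [Nat.dvd_add_right (dvd_mul_right e j), Nat.dvd_one] at this

/-- The integral closure of the valuation ring in `L` is a Dedekind domain in which `t` is not a
unit; a maximal ideal containing `t` supplies the place. -/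
theorem exists_above {K L : Type*} [Field K] [Field L] [Algebra K L] [FiniteDimensional K L]
    [Algebra.IsSeparable K L] (𝔭 : Place K) {t : L}
    (ht : IsIntegral 𝔭.valuation.valuationSubring t)
    (ht' : ¬ IsIntegral 𝔭.valuation.valuationSubring t⁻¹) :
    ∃ (𝔓 : Place L) (e : ℕ), 𝔓.HasRamificationIndex 𝔭 e ∧ 𝔓.valuation t < 1 := by
  let O := 𝔭.valuation.valuationSubring
  obtain ⟨π, hπ, hπ1, hπ2⟩ := 𝔭.exists_uniformizer
  have hπO : 𝔭.valuation π ≤ 1 := by rw [hπ1, ← exp_zero, exp_le_exp]; omega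
  have unit_iff : ∀ x : O, IsUnit x ↔ 𝔭.valuation x = 1 := fun x =>
    (Valuation.integer.integers 𝔭.valuation).isUnit_iff_valuation_eq_one (x := x)
  have : 𝔭.valuation.IsRankOneDiscrete := by
    refine ⟨⟨Units.mk0 (exp (-1 : ℤ)) exp_ne_zero, ?_, ?_⟩⟩
    · ext x
      refine ⟨fun _ => ?_, fun _ => ?_⟩
      · obtain ⟨z, hz⟩ := 𝔭.surjective x
        exact MonoidWithZeroHom.mem_valueGroup _ ⟨z, hz⟩
      · refine Subgroup.mem_zpowers_iff.2 ⟨-log (x : WithZero (Multiplicative ℤ)), ?_⟩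
        ext
        rw [Units.val_zpow_eq_zpow_val, Units.val_mk0, ← exp_zsmul]
        simp
    · rw [← Units.val_lt_val, Units.val_mk0, Units.val_one, ← exp_zero, exp_lt_exp]
      omega
  have : IsDiscreteValuationRing O := inferInstance
  let B := integralClosure O L
  have : IsDedekindDomain B := integralClosure.isDedekindDomain O K L
  have : IsFractionRing B L := integralClosure.isFractionRing_of_finite_extension K L
  let τ : B := ⟨t, ht⟩
  have hτ : ¬ IsUnit τ := by
    rintro hu
    obtain ⟨u, hu⟩ := hu.exists_right_inv
    apply ht'
    have hu' : t * (u : L) = 1 := congrArg Subtype.val hu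
    rw [← eq_inv_of_mul_eq_one_right hu']
    exact u.2
  obtain ⟨P, hP, hτP⟩ := exists_max_ideal_of_mem_nonunits hτ
  have hPO : (P.comap (algebraMap O B)).IsMaximal :=
    Ideal.isMaximal_comap_of_isIntegral_of_isMaximal P
  have hπP : algebraMap O B ⟨π, hπO⟩ ∈ P := by
    change (⟨π, hπO⟩ : O) ∈ P.comap (algebraMap O B)
    rw [IsLocalRing.eq_maximalIdeal hPO, IsLocalRing.mem_maximalIdeal, mem_nonunits_iff, unit_iff,
      hπ1, exp_eq_one]
    omega
  have hinj : Function.Injective (algebraMap O L) := by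
    rw [IsScalarTower.algebraMap_eq O K L]
    exact (algebraMap K L).injective.comp Subtype.val_injective
  let w : IsDedekindDomain.HeightOneSpectrum B := ⟨P, hP.isPrime, by
    rintro rfl
    rw [Ideal.mem_bot] at hπP
    have := congrArg (algebraMap B L) hπP
    rw [← IsScalarTower.algebraMap_apply, map_zero] at this
    exact hπ (congrArg Subtype.val (hinj (this.trans (map_zero _).symm)))⟩
  let 𝔓 : Place L := ⟨w.valuation L, w.valuation_surjective L⟩
  have hle : ∀ x : O, 𝔓.valuation (algebraMap K L x) ≤ 1 := fun x =>
    w.valuation_le_one (K := L) (algebraMap O B x)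
  have hunit : ∀ z : K, 𝔭.valuation z = 1 → 𝔓.valuation (algebraMap K L z) = 1 := by
    intro z hz
    have hz' : 𝔭.valuation z⁻¹ = 1 := by rw [map_inv₀, hz, inv_one]
    refine le_antisymm (hle ⟨z, hz.le⟩) ?_
    have h2 : 𝔓.valuation (algebraMap K L z⁻¹) ≤ 1 := hle ⟨z⁻¹, hz'.le⟩
    rw [map_inv₀, map_inv₀] at h2
    refine (inv_le_one₀ (zero_lt_iff.2 ?_)).1 h2
    refine 𝔓.valuation_ne_zero ?_
    rw [Ne, map_eq_zero]
    rintro rfl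
    simp at hz
  have hπ𝔓 : 𝔓.valuation (algebraMap K L π) < 1 :=
    (w.valuation_lt_one_iff_mem (K := L) (algebraMap O B ⟨π, hπO⟩)).2 hπP
  have hπL : algebraMap K L π ≠ 0 := by simpa using hπ
  rw [valuation_lt_one_iff _ hπL] at hπ𝔓
  -- The index is the order of `π` at 𝔓: every `z` is a power of `π` times a unit, and units at 𝔭
  -- remain units at 𝔓.
  obtain ⟨e, he⟩ := Int.eq_ofNat_of_zero_le hπ𝔓.le
  refine ⟨𝔓, e, ⟨by omega, fun z hz => ?_⟩, (w.valuation_lt_one_iff_mem (K := L) τ).2 hτP⟩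
  have hu : 𝔭.valuation (z * π ^ (-𝔭.ord z)) = 1 := by
    have hne := zpow_ne_zero (-𝔭.ord z) hπ
    rw [valuation_eq_one_iff _ (mul_ne_zero hz hne), ord_mul _ hz hne, ord_zpow, hπ2]
    ring
  have hu' := ord_eq_zero 𝔓 (hunit _ hu)
  rw [map_mul, map_zpow₀, ord_mul _ (by simpa using hz) (zpow_ne_zero _ hπL), ord_zpow, he] at hu'
  linear_combination hu'

/-! ### Finite constant fields. -/

section Constants

variable {k K : Type*} [Field k] [Field K] (𝔭 : Place K)

theorem valuation_map_eq_one [Finite k] (f : k →+* K) {x : k} (hx : x ≠ 0) :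
    𝔭.valuation (f x) = 1 := by
  have := Fintype.ofFinite k
  have h := congrArg (fun z => 𝔭.valuation (f z)) (FiniteField.pow_card_sub_one_eq_one x hx)
  simp only [map_pow, map_one] at h
  refine (pow_eq_one_iff_of_nonneg zero_le ?_).1 h
  have := Fintype.one_lt_card (α := k)
  omega

theorem valuation_natCast_eq_one [Finite k] (f : k →+* K) {n : ℕ} (hn : (n : K) ≠ 0) :
    𝔭.valuation (n : K) = 1 := by
  rw [← map_natCast f]
  refine 𝔭.valuation_map_eq_one f fun h => hn ?_
  rw [← map_natCast f, h, map_zero]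

theorem valuation_eval₂_le_one {R : Type*} [CommRing R] (f : R →+* K)
    (hf : ∀ r, 𝔭.valuation (f r) ≤ 1) {x : K} (hx : 𝔭.valuation x ≤ 1) (q : R[X]) :
    𝔭.valuation (q.eval₂ f x) ≤ 1 := by
  rw [eval₂_eq_sum_range]
  refine 𝔭.valuation.map_sum_le fun i _ => ?_
  rw [map_mul, map_pow]
  exact mul_le_one' (hf _) (pow_le_one₀ zero_le hx)

end Constants

/-! ### The residue field and Artin–Schreier reduction. -/

section ResidueField

theorem trdeg_functionField (k K : Type*) [Field k] [Field K] [Algebra (RatFunc k) K]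
    [FunctionField k K] [Algebra k K] [IsScalarTower k (RatFunc k) K] : Algebra.trdeg k K = 1 := by
  have h1 : Algebra.trdeg k (RatFunc k) = 1 := by
    have : Algebra.IsAlgebraic k[X] (RatFunc k) :=
      IsLocalization.isAlgebraic (RatFunc k) (nonZeroDivisors k[X])
    rw [← trdeg_add_eq k k[X], Polynomial.trdeg_of_isDomain,
      trdeg_eq_zero, add_zero]
  have h2 := lift_trdeg_add_eq k (RatFunc k) K
  rw [h1, trdeg_eq_zero (R := RatFunc k)] at h2
  simpa using h2.symm

variable {k K : Type*} [Field k] [Finite k] [Field K] [Algebra (RatFunc k) K]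
  [FunctionField k K] (𝔭 : Place K)

include k in
-- This makes the residue field algebraic over `k`. A uniformizer `π` is transcendental, since
-- otherwise `k(π)` would be finite and `π` would have valuation one. As `K` has transcendence
-- degree one, `x` is algebraic over `k[π]`; a primitive relation stays nonzero when `π` is set to
-- zero, and doing so changes its value at `x` only by a multiple of `π`.
theorem exists_polynomial_valuation_lt_one [Algebra k K] [IsScalarTower k (RatFunc k) K] {x : K}
    (hx : 𝔭.valuation x ≤ 1) : ∃ Q : k[X], Q ≠ 0 ∧ 𝔭.valuation (aeval x Q) < 1 := by
  have hle : ∀ r : k, 𝔭.valuation (algebraMap k K r) ≤ 1 := fun r => by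
    rcases eq_or_ne r 0 with rfl | hr
    · simp
    · exact (𝔭.valuation_map_eq_one _ hr).le
  obtain ⟨π, hπ, hπ1, hπ2⟩ := 𝔭.exists_uniformizer
  have hπlt : 𝔭.valuation π < 1 := by rw [hπ1, ← exp_zero, exp_lt_exp]; omega
  have htr : Function.Injective (aeval (R := k) π) := by
    rw [← transcendental_iff_injective]
    intro halg
    have := IntermediateField.adjoin.finiteDimensional halg.isIntegral
    have : Finite (IntermediateField.adjoin k {π}) := Module.finite_of_finite k
    have hne : IntermediateField.AdjoinSimple.gen k π ≠ 0 := fun h =>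
      hπ (by simpa using congrArg Subtype.val h)
    exact hπlt.ne (𝔭.valuation_map_eq_one (IntermediateField.adjoin k {π}).subtype hne)
  let : Algebra k[X] K := (aeval (R := k) π).toAlgebra
  have : FaithfulSMul k[X] K := (faithfulSMul_iff_algebraMap_injective _ _).2 htr
  have : IsScalarTower k k[X] K :=
    IsScalarTower.of_algebraMap_eq' (aeval (R := k) π).comp_algebraMap.symm
  have h0 : Algebra.trdeg k[X] K = 0 := by
    have h2 := lift_trdeg_add_eq k k[X] K
    rw [trdeg_functionField, Polynomial.trdeg_of_isDomain] at h2
    rw [Cardinal.lift_one, Cardinal.lift_one, ← add_zero (1 : Cardinal), add_assoc, zero_add] at h2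
    simpa using Cardinal.eq_of_add_eq_add_left h2 Cardinal.one_lt_aleph0
  rw [trdeg_eq_zero_iff] at h0
  obtain ⟨P, hP0, hP⟩ := h0.isAlgebraic x
  classical
  have hQ := aeval_primPart_eq_zero hP0 hP
  have hprim := P.isPrimitive_primPart
  set Q := P.primPart
  refine ⟨Q.map (evalRingHom 0), fun h => ?_, ?_⟩
  · have : C X ∣ Q := by
      rw [C_dvd_iff_dvd_coeff]
      intro i
      rw [X_dvd_iff, coeff_zero_eq_eval_zero, ← coe_evalRingHom, ← coeff_map, h, coeff_zero]
    exact not_isUnit_X (hprim _ this)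
  · have : C X ∣ Q - (Q.map (evalRingHom 0)).map C := by
      rw [C_dvd_iff_dvd_coeff]
      intro i
      rw [X_dvd_iff, coeff_sub, coeff_map, coeff_map]
      simp [coeff_zero_eq_eval_zero]
    obtain ⟨M, hM⟩ := this
    have h1 := congrArg (aeval x) hM
    rw [map_sub, hQ, zero_sub, map_mul, aeval_C] at h1
    have h2 : aeval x ((Q.map (evalRingHom 0)).map C) = aeval x (Q.map (evalRingHom (0 : k))) := by
      rw [aeval_def, eval₂_map, aeval_def]
      congr 1
      ext r
      exact aeval_C π r
    have h3 : algebraMap k[X] K X = π := aeval_X π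
    rw [h2, h3] at h1
    rw [← 𝔭.valuation.map_neg, h1, map_mul]
    refine mul_lt_one_of_lt_of_le hπlt ?_
    exact 𝔭.valuation_eval₂_le_one _ (fun q => 𝔭.valuation_eval₂_le_one _ hle hπlt.le q) hx M

include k in
-- The residue field is algebraic over a finite field, hence perfect, so in characteristic 2 each
-- residue is a square.
theorem exists_valuation_sub_sq_lt_one [CharP K 2] {x : K} (hx : 𝔭.valuation x ≤ 1) :
    ∃ b : K, 𝔭.valuation b ≤ 1 ∧ 𝔭.valuation (x - b ^ 2) < 1 := by
  let : Algebra k K := ((algebraMap (RatFunc k) K).comp (algebraMap k (RatFunc k))).toAlgebra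
  have : IsScalarTower k (RatFunc k) K := IsScalarTower.of_algebraMap_eq' rfl
  have hle : ∀ r : k, 𝔭.valuation (algebraMap k K r) ≤ 1 := fun r => by
    rcases eq_or_ne r 0 with rfl | hr
    · simp
    · exact (𝔭.valuation_map_eq_one _ hr).le
  let O := 𝔭.valuation.valuationSubring
  let f : k →+* O := (algebraMap k K).codRestrict O.toSubring hle
  have unit_iff : ∀ x : O, IsUnit x ↔ 𝔭.valuation x = 1 := fun x =>
    (Valuation.integer.integers 𝔭.valuation).isUnit_iff_valuation_eq_one (x := x)
  have res_iff : ∀ x : O, IsLocalRing.residue O x = 0 ↔ 𝔭.valuation x < 1 := fun x => by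
    rw [IsLocalRing.residue_eq_zero_iff, IsLocalRing.mem_maximalIdeal, mem_nonunits_iff, unit_iff]
    exact ⟨lt_of_le_of_ne x.2, ne_of_lt⟩
  let : Algebra k (IsLocalRing.ResidueField O) := ((IsLocalRing.residue O).comp f).toAlgebra
  have halg : Algebra.IsAlgebraic k (IsLocalRing.ResidueField O) := ⟨fun z => by
    obtain ⟨x, rfl⟩ := IsLocalRing.residue_surjective z
    obtain ⟨Q, hQ, hv⟩ := 𝔭.exists_polynomial_valuation_lt_one (k := k) x.2
    refine ⟨Q, hQ, ?_⟩
    have h1 : aeval (IsLocalRing.residue O x) Q = IsLocalRing.residue O (Q.eval₂ f x) := by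
      rw [hom_eval₂]; rfl
    have h2 : ((Q.eval₂ f x : O) : K) = aeval (x : K) Q := by
      exact hom_eval₂ Q f O.subtype x
    rwa [h1, res_iff, h2]⟩
  have : PerfectField (IsLocalRing.ResidueField O) := Algebra.IsAlgebraic.perfectField k
  have : CharP k 2 := (algebraMap k K).charP (algebraMap k K).injective 2
  have : CharP (IsLocalRing.ResidueField O) 2 :=
    charP_of_injective_algebraMap (algebraMap k (IsLocalRing.ResidueField O)).injective 2
  obtain ⟨z, hz⟩ := surjective_frobenius (IsLocalRing.ResidueField O) 2
    (IsLocalRing.residue O ⟨x, hx⟩)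
  obtain ⟨b, rfl⟩ := IsLocalRing.residue_surjective z
  refine ⟨b, b.2, ?_⟩
  rw [frobenius_def, ← map_pow, eq_comm, ← sub_eq_zero, ← map_sub, res_iff] at hz
  exact hz

include k in
-- A pole of even order `2m` has leading term congruent to a square `(b s)²`. Adding `(b s)² + b s`
-- cancels it, while `b s` has order at least `m > 2m`; the pole shrinks, and the changes compose
-- because `u ↦ u² + u` is additive.
theorem exists_artinSchreier_reduced [CharP K 2] (c : K) :
    ∃ u : K, 𝔭.valuation (c + u ^ 2 + u) ≤ 1 ∨
      (𝔭.ord (c + u ^ 2 + u) < 0 ∧ ¬ (2 : ℤ) ∣ 𝔭.ord (c + u ^ 2 + u)) := by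
  have main : ∀ n : ℕ, ∀ c : K, -(n : ℤ) ≤ 𝔭.ord c → ∃ u : K, 𝔭.valuation (c + u ^ 2 + u) ≤ 1 ∨
      (𝔭.ord (c + u ^ 2 + u) < 0 ∧ ¬ (2 : ℤ) ∣ 𝔭.ord (c + u ^ 2 + u)) := by
    intro n
    induction n with
    | zero =>
      intro c hc
      refine ⟨0, Or.inl ?_⟩
      rcases eq_or_ne c 0 with rfl | hc0
      · simp
      · simpa [valuation_le_one_iff 𝔭 hc0] using hc
    | succ n ih =>
      intro c hc
      rcases eq_or_ne c 0 with rfl | hc0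
      · exact ⟨0, Or.inl (by simp)⟩
      by_cases h0 : 0 ≤ 𝔭.ord c
      · exact ⟨0, Or.inl (by simpa [valuation_le_one_iff 𝔭 hc0] using h0)⟩
      by_cases h2 : (2 : ℤ) ∣ 𝔭.ord c
      swap
      · exact ⟨0, Or.inr (by rw [zero_pow two_ne_zero, add_zero, add_zero]; exact ⟨by omega, h2⟩)⟩
      obtain ⟨m, hm⟩ := h2
      obtain ⟨s, hs, hsm⟩ := 𝔭.exists_ord_eq m
      have hc1 : 𝔭.valuation (c * (s ^ 2)⁻¹) = 1 := by
        rw [valuation_eq_one_iff _ (mul_ne_zero hc0 (inv_ne_zero (pow_ne_zero 2 hs))),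
          ord_mul _ hc0 (inv_ne_zero (pow_ne_zero 2 hs)), ord_inv, ord_pow, hsm, hm]
        push_cast; ring
      obtain ⟨b, hb, hb2⟩ := 𝔭.exists_valuation_sub_sq_lt_one (k := k) hc1.le
      have h2K : (2 : K) = 0 := CharP.cast_eq_zero K 2
      have hnew : 𝔭.valuation (c + (b * s) ^ 2 + b * s) < 𝔭.valuation c := by
        refine Valuation.map_add_lt _ ?_ ?_
        · have : c + (b * s) ^ 2 = (c * (s ^ 2)⁻¹ - b ^ 2) * s ^ 2 := by
            field_simp
            linear_combination (b ^ 2 * s ^ 2) * h2K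
          rw [this, map_mul]
          have hcs : 𝔭.valuation c = 1 * 𝔭.valuation (s ^ 2) := by
            rw [← hc1, ← map_mul, inv_mul_cancel_right₀ (pow_ne_zero 2 hs)]
          rw [hcs]
          exact mul_lt_mul_of_pos_right hb2 (zero_lt_iff.2 (𝔭.valuation_ne_zero (pow_ne_zero 2 hs)))
        · rw [map_mul]
          refine (mul_le_of_le_one_left zero_le hb).trans_lt ?_
          rw [valuation_eq_exp _ hs, valuation_eq_exp _ hc0, exp_lt_exp, hsm, hm]
          omega
      obtain ⟨u, hu⟩ := ih (c + (b * s) ^ 2 + b * s) (by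
        rcases eq_or_ne (c + (b * s) ^ 2 + b * s) 0 with h | h
        -- When the sum vanishes, its conventional order 0 still meets the bound.
        · rw [h]; simp [ord]
        rw [valuation_eq_exp _ h, valuation_eq_exp _ hc0, exp_lt_exp] at hnew
        push_cast at hc
        omega)
      have : c + (b * s) ^ 2 + b * s + u ^ 2 + u = c + (b * s + u) ^ 2 + (b * s + u) := by
        linear_combination -(b * s * u) * h2K
      rw [this] at hu
      exact ⟨b * s + u, hu⟩
  exact main (-𝔭.ord c).toNat c (by omega)

end ResidueField

end Place

/-! ### Generators, separability and integrality. -/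

theorem Algebra.adjoin_singleton_eq_top_of_mem {K L : Type*} [Field K] [Field L] [Algebra K L]
    [FiniteDimensional K L] {y s : L} (hy : IntermediateField.adjoin K {y} = ⊤)
    (hs : y ∈ IntermediateField.adjoin K {s}) : Algebra.adjoin K {s} = ⊤ := by
  have h1 : IntermediateField.adjoin K {s} = ⊤ := by
    refine top_unique ?_
    rw [← hy, IntermediateField.adjoin_simple_le_iff]
    exact hs
  rw [← IntermediateField.adjoin_simple_toSubalgebra_of_isAlgebraic
    (Algebra.IsAlgebraic.isAlgebraic s), h1, IntermediateField.top_toSubalgebra]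

theorem Algebra.isSeparable_of_adjoin_eq_top {K L : Type*} [Field K] [Field L] [Algebra K L]
    {y : L} (hy : IntermediateField.adjoin K {y} = ⊤) (hs : IsSeparable K y) :
    Algebra.IsSeparable K L := by
  have := (IntermediateField.isSeparable_adjoin_simple_iff_isSeparable K L).2 hs
  rw [hy] at this
  exact AlgEquiv.Algebra.isSeparable (IntermediateField.topEquiv (F := K) (E := L))

theorem Polynomial.separable_X_sq_add {K : Type*} [Field K] {b c : K} (h : b ^ 2 - 4 * c ≠ 0) :
    (X ^ 2 + C b * X + C c).Separable := by
  refine ⟨C (-4 / (b ^ 2 - 4 * c)), C (1 / (b ^ 2 - 4 * c)) * (C 2 * X + C b), ?_⟩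
  have h1 : C (b ^ 2 - 4 * c)⁻¹ * (C b ^ 2 - 4 * C c) = 1 := by
    rw [← C_1, ← inv_mul_cancel₀ h]
    simp only [map_mul, map_sub, map_pow, map_ofNat]
  simp only [derivative_add, derivative_X_pow, derivative_C_mul, derivative_X, derivative_C,
    div_eq_mul_inv, map_mul, map_neg, map_ofNat, one_mul]
  push_cast
  simp only [map_ofNat]
  linear_combination h1

theorem Int.gcd_eq_one_iff_not_dvd {p : ℕ} (hp : p.Prime) (x : ℤ) :
    Int.gcd x p = 1 ↔ ¬ (p : ℤ) ∣ x := by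
  rw [Int.natCast_dvd, ← hp.coprime_iff_not_dvd, Nat.coprime_comm]
  rfl

namespace Place

theorem valuation_le_one_of_isIntegral {K L : Type*} [Field K] [Field L] [Algebra K L]
    {𝔓 : Place L} {𝔭 : Place K} {e : ℕ} (h : 𝔓.HasRamificationIndex 𝔭 e) {s : L}
    (hs : IsIntegral 𝔭.valuation.valuationSubring s) : 𝔓.valuation s ≤ 1 := by
  obtain ⟨f, hf, hf0⟩ := hs
  let φ : 𝔭.valuation.valuationSubring →+* 𝔓.valuation.valuationSubring :=
    ((algebraMap K L).comp (ValuationSubring.subtype _)).codRestrict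
      𝔓.valuation.valuationSubring.toSubring fun x => h.valuation_le_one x.2
  have h1 : IsIntegral 𝔓.valuation.valuationSubring s := by
    refine ⟨f.map φ, hf.map φ, ?_⟩
    rw [eval₂_map]
    exact hf0
  obtain ⟨x, rfl⟩ := IsIntegrallyClosed.isIntegral_iff.1 h1
  exact x.2

theorem isIntegral_of_cubic {K L : Type*} [Field K] [Field L] [Algebra K L] {𝔭 : Place K}
    {s : L} {a₂ a₁ a₀ : K} (h₂ : 𝔭.valuation a₂ ≤ 1) (h₁ : 𝔭.valuation a₁ ≤ 1)
    (h₀ : 𝔭.valuation a₀ ≤ 1) (hs : s ^ 3 + algebraMap K L a₂ * s ^ 2 + algebraMap K L a₁ * s +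
      algebraMap K L a₀ = 0) : IsIntegral 𝔭.valuation.valuationSubring s := by
  let O := 𝔭.valuation.valuationSubring
  refine ⟨X ^ 3 + C (⟨a₂, h₂⟩ : O) * X ^ 2 + C (⟨a₁, h₁⟩ : O) * X + C (⟨a₀, h₀⟩ : O),
    by monicity!, ?_⟩
  simp only [eval₂_add, eval₂_mul, eval₂_C, eval₂_X_pow, eval₂_X]
  exact hs

/-- The leading coefficient may vanish or be a non-unit: this covers quadratic equations, and cubics
whose degree drops modulo 𝔭. -/
theorem HasRamificationIndex.eq_one_of_cubic {K L : Type*} [Field K] [Field L] [Algebra K L]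
    {𝔓 : Place L} {𝔭 : Place K} {e : ℕ} (h : 𝔓.HasRamificationIndex 𝔭 e) {s : L}
    (hs : Algebra.adjoin K {s} = ⊤) (hs1 : 𝔓.valuation s ≤ 1) {a₃ a₂ a₁ a₀ : K}
    (h₃ : 𝔭.valuation a₃ ≤ 1) (h₂ : 𝔭.valuation a₂ ≤ 1) (h₁ : 𝔭.valuation a₁ ≤ 1)
    (h₀ : 𝔭.valuation a₀ ≤ 1)
    (h0 : algebraMap K L a₃ * s ^ 3 + algebraMap K L a₂ * s ^ 2 + algebraMap K L a₁ * s +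
      algebraMap K L a₀ = 0)
    (h' : 𝔓.valuation (3 * algebraMap K L a₃ * s ^ 2 + 2 * algebraMap K L a₂ * s +
      algebraMap K L a₁) = 1) : e = 1 := by
  refine h.eq_one_of_simple_root hs hs1 (Cubic.toPoly ⟨a₃, a₂, a₁, a₀⟩) ?_ ?_ ?_
  · intro i
    match i with
    | 0 => simpa using h₀
    | 1 => simpa using h₁
    | 2 => simpa using h₂
    | 3 => simpa using h₃
    | n + 4 => rw [Cubic.coeff_eq_zero (by omega)]; simp
  · simpa [Cubic.toPoly] using h0
  · rw [← h']
    congr 1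
    have h2 : algebraMap K L 2 = 2 := map_ofNat _ 2
    simp [Cubic.toPoly]
    linear_combination (algebraMap K L a₃ * s ^ 2) * h2

theorem exists_above_self {K L : Type*} [Field K] [Field L] [Algebra K L] [FiniteDimensional K L]
    [Algebra.IsSeparable K L] (𝔭 : Place K) :
    ∃ (𝔓 : Place L) (e : ℕ), 𝔓.HasRamificationIndex 𝔭 e := by
  obtain ⟨π, hπ, -, hπ1⟩ := 𝔭.exists_uniformizer
  have hlt : 𝔭.valuation π < 1 := by rw [valuation_lt_one_iff _ hπ]; omega
  obtain ⟨𝔓, e, h, -⟩ := 𝔭.exists_above (L := L) (t := algebraMap K L π)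
    (isIntegral_algebraMap (R := 𝔭.valuation.valuationSubring) (x := ⟨π, hlt.le⟩)) (by
      rw [← map_inv₀, isIntegral_algebraMap_iff (algebraMap K L).injective,
        IsIntegrallyClosed.isIntegral_iff]
      rintro ⟨x, hx⟩
      have := x.2
      have hx' : (x : K) = π⁻¹ := hx
      change 𝔭.valuation (x : K) ≤ 1 at this
      rw [hx', valuation_le_one_iff _ (inv_ne_zero hπ), ord_inv] at this
      omega)
  exact ⟨𝔓, e, h⟩

/-- Orders of the solutions of `z ^ 2 + z = d` when `d` has a pole. -/
theorem two_mul_ord_of_sq_add_self {L : Type*} [Field L] (𝔓 : Place L) {z d : L}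
    (hz : z ^ 2 + z = d) (hd : 1 < 𝔓.valuation d) : 2 * 𝔓.ord z = 𝔓.ord d := by
  have hz1 : 1 < 𝔓.valuation z := by
    by_contra! hle
    refine hd.not_ge ?_
    rw [← hz]
    refine 𝔓.valuation.map_add_le ?_ hle
    rw [map_pow]
    exact pow_le_one₀ zero_le hle
  have : 𝔓.valuation d = 𝔓.valuation (z ^ 2) := by
    rw [← hz]
    refine Valuation.map_add_eq_of_lt_left _ ?_
    rw [map_pow]
    exact lt_self_pow₀ hz1 (by norm_num)
  rw [ord_eq_of_valuation_eq_valuation 𝔓 this, ord_pow]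
  rfl

theorem valuation_le_one_of_sq_add_self {L : Type*} [Field L] (𝔓 : Place L) {z d : L}
    (hz : z ^ 2 + z = d) (hd : 𝔓.valuation d ≤ 1) : 𝔓.valuation z ≤ 1 := by
  by_contra! hlt
  have : 𝔓.valuation d = 𝔓.valuation (z ^ 2) := by
    rw [← hz]
    refine Valuation.map_add_eq_of_lt_left _ ?_
    rw [map_pow]
    exact lt_self_pow₀ hlt (by norm_num)
  rw [this, map_pow] at hd
  exact hd.not_gt (one_lt_pow₀ hlt (by norm_num))

/-! ### Kummer and Artin–Schreier equations of degree two. -/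

section Quadratic

variable {K M : Type*} [Field K] [Field M] [Algebra K M] {𝔓 : Place M} {𝔭 : Place K} {e : ℕ}

theorem HasRamificationIndex.two_dvd_of_sq (h : 𝔓.HasRamificationIndex 𝔭 e) {ρ : M} {d : K}
    (hd : d ≠ 0) (hρ : ρ ^ 2 = algebraMap K M d) (hodd : ¬ (2 : ℤ) ∣ 𝔭.ord d) : 2 ∣ e := by
  have h1 := h.2 d hd
  rw [← hρ, ord_pow] at h1
  have h2 : (2 : ℤ) ∣ e * 𝔭.ord d := ⟨_, h1.symm⟩
  have := (Int.prime_two.dvd_mul.1 h2).resolve_right hodd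
  exact_mod_cast this

theorem HasRamificationIndex.eq_one_of_sq (h : 𝔓.HasRamificationIndex 𝔭 e)
    (h2 : 𝔭.valuation 2 = 1) {ρ : M} {d : K} (hgen : Algebra.adjoin K {ρ} = ⊤)
    (hd : d ≠ 0) (hρ : ρ ^ 2 = algebraMap K M d) (heven : (2 : ℤ) ∣ 𝔭.ord d) : e = 1 := by
  obtain ⟨m, hm⟩ := heven
  obtain ⟨z, hz, hzm⟩ := 𝔭.exists_ord_eq (-m)
  have hzM : algebraMap K M z ≠ 0 := by simpa using hz
  set s := algebraMap K M z * ρ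
  have hs2 : s ^ 2 = algebraMap K M (z ^ 2 * d) := by simp [s, mul_pow, hρ]
  have hu : 𝔭.valuation (z ^ 2 * d) = 1 := by
    rw [valuation_eq_one_iff _ (mul_ne_zero (pow_ne_zero 2 hz) hd),
      ord_mul _ (pow_ne_zero 2 hz) hd, ord_pow, hzm, hm]
    push_cast; ring
  have hs1 : 𝔓.valuation s = 1 := by
    have := h.valuation_eq_one hu
    rw [← hs2, map_pow] at this
    exact (pow_eq_one_iff_of_nonneg zero_le two_ne_zero).1 this
  have hgen' : Algebra.adjoin K {s} = ⊤ := by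
    rw [eq_top_iff, ← hgen, Algebra.adjoin_le_iff, Set.singleton_subset_iff, SetLike.mem_coe]
    have : ρ = z⁻¹ • s := by
      rw [Algebra.smul_def, map_inv₀]
      field_simp
      exact mul_comm _ _
    rw [this]
    exact Subalgebra.smul_mem _ (Algebra.self_mem_adjoin_singleton K s) _
  refine h.eq_one_of_cubic hgen' hs1.le (a₃ := 0) (a₂ := 1) (a₁ := 0) (a₀ := -(z ^ 2 * d))
    (by simp) (by simp) (by simp) (by rw [Valuation.map_neg, hu]) ?_ ?_
  · rw [map_neg, ← hs2]
    simp
  · have h2' := h.valuation_eq_one h2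
    rw [map_ofNat] at h2'
    simp [hs1, h2']

/-- The integral error `ε` does not affect the pole. It is zero for the resolvent and `t / (1 + t)`
for the cubic. -/
theorem HasRamificationIndex.two_dvd_of_artinSchreier (h : 𝔓.HasRamificationIndex 𝔭 e) {z ε : M}
    {d : K} (hz : z ^ 2 + z = algebraMap K M d + ε) (hε : 𝔓.valuation ε ≤ 1)
    (hd : 𝔭.ord d < 0) (hodd : ¬ (2 : ℤ) ∣ 𝔭.ord d) : 2 ∣ e := by
  have hd0 : d ≠ 0 := by
    rintro rfl
    simp [ord] at hd
  have hd1 : 1 < 𝔓.valuation (algebraMap K M d) := by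
    rw [h.valuation_algebraMap]
    exact one_lt_pow₀ ((one_lt_valuation_iff _ hd0).2 hd) h.1.ne'
  have hv : 𝔓.valuation (algebraMap K M d + ε) = 𝔓.valuation (algebraMap K M d) :=
    Valuation.map_add_eq_of_lt_left _ (hε.trans_lt hd1)
  have h1 := 𝔓.two_mul_ord_of_sq_add_self hz (by rwa [hv])
  rw [ord_eq_of_valuation_eq_valuation 𝔓 hv, h.2 d hd0] at h1
  have h2 : (2 : ℤ) ∣ e * 𝔭.ord d := ⟨_, h1.symm⟩
  have := (Int.prime_two.dvd_mul.1 h2).resolve_right hodd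
  exact_mod_cast this

theorem HasRamificationIndex.eq_one_of_artinSchreier (h : 𝔓.HasRamificationIndex 𝔭 e)
    (h2 : (2 : K) = 0) {z : M} {d : K} (hgen : Algebra.adjoin K {z} = ⊤)
    (hz : z ^ 2 + z = algebraMap K M d) (hd : 𝔭.valuation d ≤ 1) : e = 1 := by
  have h2' : (2 : M) = 0 := by
    rw [← map_ofNat (algebraMap K M) 2, h2, map_zero]
  refine h.eq_one_of_cubic hgen (𝔓.valuation_le_one_of_sq_add_self hz (h.valuation_le_one hd))
    (a₃ := 0) (a₂ := 1) (a₁ := 1) (a₀ := -d) (by simp) (by simp) (by simp)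
    (by rwa [Valuation.map_neg]) ?_ ?_
  · rw [map_neg, ← hz]
    simp
  · simp [h2']

end Quadratic

end Place

namespace Place

namespace HasRamificationIndex

variable {K L : Type*} [Field K] [Field L] [Algebra K L] {𝔓 : Place L} {𝔭 : Place K} {e : ℕ}

/-! ### The cubic at poles of `a` and away from `a ≡ ±2`. -/

section Depressed

variable {y : L} {a : K}

theorem three_dvd_of_pole (h : 𝔓.HasRamificationIndex 𝔭 e)
    (hy : y ^ 3 - 3 * y = algebraMap K L a) (h3 : 𝔭.valuation 3 = 1) (ha : 𝔭.ord a < 0)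
    (ha3 : ¬ (3 : ℤ) ∣ 𝔭.ord a) : 3 ∣ e := by
  -- The conventional order of 0 is 0, so a negative order excludes `a = 0`.
  have ha0 : a ≠ 0 := by
    rintro rfl
    simp [ord] at ha
  have ha1 : 1 < 𝔓.valuation (algebraMap K L a) := by
    rw [h.valuation_algebraMap]
    exact one_lt_pow₀ ((one_lt_valuation_iff _ ha0).2 ha) h.1.ne'
  have h3' : 𝔓.valuation 3 = 1 := by
    rw [← map_ofNat (algebraMap K L) 3]
    exact h.valuation_eq_one h3
  have hy1 : 1 < 𝔓.valuation y := by
    by_contra! hle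
    refine ha1.not_ge ?_
    rw [← hy]
    refine 𝔓.valuation.map_sub_le ?_ ?_
    · rw [map_pow]
      exact pow_le_one₀ zero_le hle
    · rwa [map_mul, h3', one_mul]
  have hv : 𝔓.valuation (algebraMap K L a) = 𝔓.valuation (y ^ 3) := by
    rw [← hy]
    refine Valuation.map_sub_eq_of_lt_left _ ?_
    rw [map_pow, map_mul, h3', one_mul]
    exact lt_self_pow₀ hy1 (by norm_num)
  have h1 := ord_eq_of_valuation_eq_valuation 𝔓 hv
  rw [h.2 a ha0, ord_pow] at h1
  have := (Int.prime_three.dvd_mul.1 ⟨_, h1⟩).resolve_right ha3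
  exact_mod_cast this

/-- With `3 ord z = -ord a`, the element `s = z y` is a root of `X³ - 3z²X - z³a`. Modulo 𝔭 this is
`X³` minus a unit, separable because 3 is a unit. -/
theorem eq_one_of_pole [FiniteDimensional K L] (h : 𝔓.HasRamificationIndex 𝔭 e)
    (hgen : IntermediateField.adjoin K {y} = ⊤)
    (hy : y ^ 3 - 3 * y = algebraMap K L a) (h3 : 𝔭.valuation 3 = 1) (ha : 𝔭.ord a < 0)
    (ha3 : (3 : ℤ) ∣ 𝔭.ord a) : e = 1 := by
  have ha0 : a ≠ 0 := by
    rintro rfl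
    simp [ord] at ha
  obtain ⟨m, hm⟩ := ha3
  obtain ⟨z, hz, hzm⟩ := 𝔭.exists_ord_eq (-m)
  have hz1 : 𝔭.valuation z < 1 := by rw [valuation_lt_one_iff _ hz]; omega
  have hzL : algebraMap K L z ≠ 0 := by simpa using hz
  have h3' : 𝔓.valuation 3 = 1 := by
    rw [← map_ofNat (algebraMap K L) 3]
    exact h.valuation_eq_one h3
  have hu : 𝔭.valuation (z ^ 3 * a) = 1 := by
    rw [valuation_eq_one_iff _ (mul_ne_zero (pow_ne_zero 3 hz) ha0),
      ord_mul _ (pow_ne_zero 3 hz) ha0, ord_pow, hzm, hm]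
    push_cast; ring
  have hz2 : 𝔭.valuation (-(3 * z ^ 2)) < 1 := by
    rw [Valuation.map_neg, map_mul, h3, one_mul, map_pow]
    exact pow_lt_one₀ zero_le hz1 two_ne_zero
  have hs0 : (algebraMap K L z * y) ^ 3 + algebraMap K L (-(3 * z ^ 2)) * (algebraMap K L z * y) +
      algebraMap K L (-(z ^ 3 * a)) = 0 := by
    simp only [map_neg, map_mul, map_pow, ← hy, map_ofNat]
    ring
  have hgen' : Algebra.adjoin K {algebraMap K L z * y} = ⊤ := by
    refine Algebra.adjoin_singleton_eq_top_of_mem hgen ?_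
    have := mul_mem (IntermediateField.algebraMap_mem _ z⁻¹)
      (IntermediateField.mem_adjoin_simple_self K (algebraMap K L z * y))
    rwa [map_inv₀, inv_mul_cancel_left₀ hzL] at this
  generalize algebraMap K L z * y = s at hs0 hgen'
  have hs1 : 𝔓.valuation s ≤ 1 := by
    refine valuation_le_one_of_isIntegral h (isIntegral_of_cubic (a₂ := 0) (by simp) hz2.le
      (a₀ := -(z ^ 3 * a)) (by rw [Valuation.map_neg, hu]) ?_)
    rw [map_zero, zero_mul, add_zero]
    exact hs0
  have hs : 𝔓.valuation s = 1 := by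
    refine le_antisymm hs1 ?_
    have h1 : s * (s ^ 2 + algebraMap K L (-(3 * z ^ 2))) = algebraMap K L (z ^ 3 * a) := by
      rw [map_neg _ (z ^ 3 * a)] at hs0
      linear_combination hs0
    have h2 := h.valuation_eq_one hu
    rw [← h1, map_mul] at h2
    rw [← h2]
    refine mul_le_of_le_one_right zero_le (𝔓.valuation.map_add_le ?_ (h.valuation_le_one hz2.le))
    rw [map_pow]
    exact pow_le_one₀ zero_le hs1
  refine h.eq_one_of_cubic hgen' hs1 (a₃ := 1) (a₂ := 0) (a₁ := -(3 * z ^ 2))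
    (a₀ := -(z ^ 3 * a)) (by simp) (by simp) hz2.le (by rw [Valuation.map_neg, hu]) ?_ ?_
  · rw [← hs0, map_one, map_zero]
    ring
  · rw [map_one, map_zero, mul_zero, zero_mul, add_zero, mul_one]
    have h4 : 𝔓.valuation (3 * s ^ 2) = 1 := by rw [map_mul, h3', map_pow, hs, one_pow, one_mul]
    rw [Valuation.map_add_eq_of_lt_left _ (by rw [h4]; exact h.valuation_lt_one hz2), h4]

/-- From `(y² - 1)²(y² - 4) = a² - 4`, a unit, the factor `y² - 1` is a unit, and so is the
derivative `3(y² - 1)`. -/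
theorem eq_one_of_not_modEq [FiniteDimensional K L] (h : 𝔓.HasRamificationIndex 𝔭 e)
    (hgen : IntermediateField.adjoin K {y} = ⊤)
    (hy : y ^ 3 - 3 * y = algebraMap K L a) (h3 : 𝔭.valuation 3 = 1) (ha : 𝔭.valuation a ≤ 1)
    (h1 : 𝔭.valuation (a - 2) = 1) (h2 : 𝔭.valuation (a + 2) = 1) : e = 1 := by
  have h3' : 𝔓.valuation 3 = 1 := by
    rw [← map_ofNat (algebraMap K L) 3]
    exact h.valuation_eq_one h3
  have hy0 : y ^ 3 + algebraMap K L 0 * y ^ 2 + algebraMap K L (-3) * y + algebraMap K L (-a)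
      = 0 := by
    rw [map_zero, map_neg, map_neg, map_ofNat, ← hy]
    ring
  have hy1 : 𝔓.valuation y ≤ 1 := valuation_le_one_of_isIntegral h
    (isIntegral_of_cubic (by simp) (by rw [Valuation.map_neg, h3])
      (by rwa [Valuation.map_neg]) hy0)
  have hi : ∀ n : ℤ, 𝔓.valuation (n : L) ≤ 1 := fun n =>
    (n : 𝔓.valuation.valuationSubring).2
  have hy2 : ∀ n : ℤ, 𝔓.valuation (y ^ 2 - n) ≤ 1 := fun n => by
    refine 𝔓.valuation.map_sub_le ?_ (hi n)
    rw [map_pow]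
    exact pow_le_one₀ zero_le hy1
  have hdisc : 𝔓.valuation ((y ^ 2 - (1 : ℤ)) * ((y ^ 2 - (1 : ℤ)) * (y ^ 2 - (4 : ℤ)))) = 1 := by
    have : (y ^ 2 - (1 : ℤ)) * ((y ^ 2 - (1 : ℤ)) * (y ^ 2 - (4 : ℤ))) =
        algebraMap K L ((a - 2) * (a + 2)) := by
      rw [map_mul, map_add, map_sub, map_ofNat, ← hy]
      push_cast
      ring
    rw [this]
    exact h.valuation_eq_one (by rw [map_mul, h1, h2, one_mul])
  have hu : 𝔓.valuation (y ^ 2 - (1 : ℤ)) = 1 := by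
    refine le_antisymm (hy2 1) ?_
    rw [map_mul, map_mul] at hdisc
    rw [← hdisc]
    exact mul_le_of_le_one_right zero_le (mul_le_one' (hy2 1) (hy2 4))
  refine h.eq_one_of_cubic (Algebra.adjoin_singleton_eq_top_of_mem hgen
    (IntermediateField.mem_adjoin_simple_self K y)) hy1 (a₃ := 1) (a₂ := 0) (a₁ := -3)
    (a₀ := -a) (by simp) (by simp) (by rw [Valuation.map_neg, h3]) (by rwa [Valuation.map_neg])
    (by rw [map_one, one_mul]; exact hy0) ?_
  have : 3 * algebraMap K L 1 * y ^ 2 + 2 * algebraMap K L 0 * y + algebraMap K L (-3) =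
      3 * (y ^ 2 - (1 : ℤ)) := by
    rw [map_one, map_zero, map_neg, map_ofNat]
    push_cast
    ring
  rw [this, map_mul, h3', hu, one_mul]

end Depressed

/-! ### The equation `t²(3 - t) = c` with `c` vanishing at the place. -/

section Split

variable {t : L} {c : K}

theorem isIntegral_of_split (ht : t ^ 2 * (3 - t) = algebraMap K L c) (h3 : 𝔭.valuation 3 = 1)
    (hc : 𝔭.valuation c < 1) : IsIntegral 𝔭.valuation.valuationSubring t := by
  refine isIntegral_of_cubic (a₂ := -3) (a₁ := 0) (a₀ := c) (by rw [Valuation.map_neg, h3])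
    (by simp) hc.le ?_
  rw [map_neg, map_ofNat, map_zero, ← ht]
  ring

theorem eq_one_of_split_unit [FiniteDimensional K L] (h : 𝔓.HasRamificationIndex 𝔭 e)
    (hgen : IntermediateField.adjoin K {t} = ⊤)
    (ht : t ^ 2 * (3 - t) = algebraMap K L c) (h3 : 𝔭.valuation 3 = 1)
    (hc : 𝔭.valuation c < 1) (ht1 : 𝔓.valuation t = 1) : e = 1 := by
  have h3' : 𝔓.valuation 3 = 1 := by
    rw [← map_ofNat (algebraMap K L) 3]
    exact h.valuation_eq_one h3
  have h4 : 𝔓.valuation (3 - t) < 1 := by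
    have := h.valuation_lt_one hc
    rwa [← ht, map_mul, map_pow, ht1, one_pow, one_mul] at this
  refine h.eq_one_of_cubic (Algebra.adjoin_singleton_eq_top_of_mem hgen
    (IntermediateField.mem_adjoin_simple_self K t)) ht1.le (a₃ := 1) (a₂ := -3) (a₁ := 0) (a₀ := c)
    (by simp) (by rw [Valuation.map_neg, h3]) (by simp) hc.le ?_ ?_
  · rw [map_one, map_neg, map_ofNat, map_zero, ← ht]
    ring
  · have : 3 * algebraMap K L 1 * t ^ 2 + 2 * algebraMap K L (-3) * t + algebraMap K L 0 =
        3 * t * (1 - (3 - t)) := by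
      rw [map_one, map_neg, map_ofNat, map_zero]
      ring
    have h5 : 𝔓.valuation (1 - (3 - t)) = 1 := by
      rw [Valuation.map_sub_eq_of_lt_left _ (by rwa [map_one]), map_one]
    rw [this, map_mul, map_mul, h3', ht1, h5, one_mul, one_mul]

theorem two_mul_ord_of_split (h : 𝔓.HasRamificationIndex 𝔭 e)
    (ht : t ^ 2 * (3 - t) = algebraMap K L c) (h3 : 𝔭.valuation 3 = 1)
    (hc0 : c ≠ 0) (ht1 : 𝔓.valuation t < 1) : 2 * 𝔓.ord t = e * 𝔭.ord c := by
  have h3' : 𝔓.valuation 3 = 1 := by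
    rw [← map_ofNat (algebraMap K L) 3]
    exact h.valuation_eq_one h3
  have h4 : 𝔓.valuation (3 - t) = 1 := by
    rw [Valuation.map_sub_eq_of_lt_left _ (by rwa [h3']), h3']
  have h5 : 𝔓.valuation (algebraMap K L c) = 𝔓.valuation (t ^ 2) := by
    rw [← ht, map_mul, h4, mul_one]
  rw [← h.2 c hc0, ord_eq_of_valuation_eq_valuation 𝔓 h5, ord_pow]
  rfl

theorem two_dvd_of_split (h : 𝔓.HasRamificationIndex 𝔭 e)
    (ht : t ^ 2 * (3 - t) = algebraMap K L c) (h3 : 𝔭.valuation 3 = 1)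
    (hc0 : c ≠ 0) (ht1 : 𝔓.valuation t < 1) (hodd : ¬ (2 : ℤ) ∣ 𝔭.ord c) : 2 ∣ e := by
  have := (Int.prime_two.dvd_mul.1 ⟨_, (h.two_mul_ord_of_split ht h3 hc0 ht1).symm⟩).resolve_right
    hodd
  exact_mod_cast this

/-- With `2 ord z = ord c`, the unit `s = t / z` satisfies `z s³ - 3 s² + c / z² = 0`, whose
derivative is congruent to the unit `-6 s`. -/
theorem eq_one_of_split [FiniteDimensional K L] (h : 𝔓.HasRamificationIndex 𝔭 e)
    (hgen : IntermediateField.adjoin K {t} = ⊤)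
    (ht : t ^ 2 * (3 - t) = algebraMap K L c) (h3 : 𝔭.valuation 3 = 1) (h2 : 𝔭.valuation 2 = 1)
    (hc : 𝔭.valuation c < 1) (hc0 : c ≠ 0) (ht1 : 𝔓.valuation t < 1)
    (heven : (2 : ℤ) ∣ 𝔭.ord c) : e = 1 := by
  have h3' : 𝔓.valuation 3 = 1 := by
    rw [← map_ofNat (algebraMap K L) 3]
    exact h.valuation_eq_one h3
  have h2' : 𝔓.valuation 2 = 1 := by
    rw [← map_ofNat (algebraMap K L) 2]
    exact h.valuation_eq_one h2
  have hord := h.two_mul_ord_of_split ht h3 hc0 ht1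
  obtain ⟨m, hm⟩ := heven
  rw [valuation_lt_one_iff _ hc0] at hc
  obtain ⟨z, hz, hzm⟩ := 𝔭.exists_ord_eq m
  have hz1 : 𝔭.valuation z < 1 := by rw [valuation_lt_one_iff _ hz]; omega
  have hzL : algebraMap K L z ≠ 0 := by simpa using hz
  have ht0 : t ≠ 0 := by
    rintro rfl
    refine hc0 ((algebraMap K L).injective ?_)
    rw [← ht]
    simp
  have hne : t * (algebraMap K L z)⁻¹ ≠ 0 := mul_ne_zero ht0 (inv_ne_zero hzL)
  have hs1 : 𝔓.valuation (t * (algebraMap K L z)⁻¹) = 1 := by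
    rw [valuation_eq_one_iff _ hne, ord_mul _ ht0 (inv_ne_zero hzL), ord_inv, h.2 z hz, hzm]
    rw [hm] at hord
    linarith
  have hgen' : Algebra.adjoin K {t * (algebraMap K L z)⁻¹} = ⊤ := by
    refine Algebra.adjoin_singleton_eq_top_of_mem hgen ?_
    have := mul_mem
      (IntermediateField.mem_adjoin_simple_self K (t * (algebraMap K L z)⁻¹))
      (IntermediateField.algebraMap_mem _ z)
    rwa [inv_mul_cancel_right₀ hzL] at this
  have hu : 𝔭.valuation (c * (z ^ 2)⁻¹) = 1 := by
    have hz2 := inv_ne_zero (pow_ne_zero 2 hz)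
    rw [valuation_eq_one_iff _ (mul_ne_zero hc0 hz2), ord_mul _ hc0 hz2, ord_inv, ord_pow, hzm, hm]
    push_cast; ring
  refine h.eq_one_of_cubic hgen' hs1.le (a₃ := z) (a₂ := -3) (a₁ := 0)
    (a₀ := c * (z ^ 2)⁻¹) hz1.le (by rw [Valuation.map_neg, h3]) (by simp) hu.le ?_ ?_
  · rw [map_neg, map_ofNat, map_zero, map_mul, ← ht, map_inv₀, map_pow]
    field_simp
    ring
  · generalize t * (algebraMap K L z)⁻¹ = s at hs1
    rw [map_neg, map_ofNat, map_zero, add_zero]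
    have h5 : 𝔓.valuation (2 * -3 * s) = 1 := by
      rw [map_mul, map_mul, Valuation.map_neg, h2', h3', hs1, one_mul, one_mul]
    rw [Valuation.map_add_eq_of_lt_right _ _, h5]
    rw [h5, map_mul, map_mul, h3', map_pow, hs1, one_pow, mul_one, one_mul]
    exact h.valuation_lt_one hz1

/-- Since `c = t²(1 + t)` in characteristic 2, `1/t² + 1/t = (1 + t)²/c = 1/c + 1 + t/(1 + t)`;
translating by `u` adds `u² + u`. -/
theorem two_dvd_of_split_char_two (h : 𝔓.HasRamificationIndex 𝔭 e)
    (ht : t ^ 2 * (3 - t) = algebraMap K L c) (h2 : (2 : K) = 0) (hc0 : c ≠ 0)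
    (ht1 : 𝔓.valuation t < 1) {u : K} (hu : 𝔭.ord (1 / c + 1 + u ^ 2 + u) < 0)
    (hodd : ¬ (2 : ℤ) ∣ 𝔭.ord (1 / c + 1 + u ^ 2 + u)) : 2 ∣ e := by
  have h2' : (2 : L) = 0 := by rw [← map_ofNat (algebraMap K L) 2, h2, map_zero]
  have hcL : algebraMap K L c ≠ 0 := by simpa using hc0
  have h4 : 𝔓.valuation (1 + t) = 1 := by
    rw [Valuation.map_add_eq_of_lt_left _ (by rwa [map_one]), map_one]
  have h5 : 1 + t ≠ 0 := by
    intro h0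
    rw [h0, map_zero] at h4
    exact zero_ne_one h4
  have ht0 : t ≠ 0 := by
    rintro rfl
    exact hcL (by rw [← ht]; simp)
  have ht' : algebraMap K L c = t ^ 2 * (1 + t) := by
    rw [← ht]
    linear_combination (t ^ 2 - t ^ 3) * h2'
  refine h.two_dvd_of_artinSchreier (z := 1 / t + algebraMap K L u) (ε := t / (1 + t)) ?_ ?_ hu hodd
  · simp only [map_add, map_div₀, map_one, map_pow, ht']
    field_simp
    linear_combination ((1 + t) * algebraMap K L u * t - t ^ 3 + t) * h2'
  · rw [map_div₀, h4, div_one]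
    exact ht1.le

theorem eq_one_of_split_char_two [FiniteDimensional K L] (h : 𝔓.HasRamificationIndex 𝔭 e)
    (hgen : IntermediateField.adjoin K {t} = ⊤)
    (ht : t ^ 2 * (3 - t) = algebraMap K L c) (h2 : (2 : K) = 0)
    (hc : 𝔭.valuation c < 1) (hc0 : c ≠ 0) (ht1 : 𝔓.valuation t < 1) {u : K}
    (hu : 𝔭.valuation (1 / c + 1 + u ^ 2 + u) ≤ 1) : e = 1 := by
  have h2' : (2 : L) = 0 := by rw [← map_ofNat (algebraMap K L) 2, h2, map_zero]
  have hcL : algebraMap K L c ≠ 0 := by simpa using hc0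
  have h4 : 𝔓.valuation (1 + t) = 1 := by
    rw [Valuation.map_add_eq_of_lt_left _ (by rwa [map_one]), map_one]
  have h5 : 1 + t ≠ 0 := by
    intro h0
    rw [h0, map_zero] at h4
    exact zero_ne_one h4
  have ht0 : t ≠ 0 := by
    rintro rfl
    exact hcL (by rw [← ht]; simp)
  have ht' : algebraMap K L c = t ^ 2 * (1 + t) := by
    rw [← ht]
    linear_combination (t ^ 2 - t ^ 3) * h2'
  -- Only a pole of `u` can cancel the pole of `1 / c`.
  have hu1 : 1 < 𝔭.valuation u := by
    by_contra! hle
    have h6 : 1 < 𝔭.valuation (1 / c) := by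
      rw [map_div₀, map_one, one_div]
      exact (one_lt_inv₀ (zero_lt_iff.2 (𝔭.valuation_ne_zero hc0))).2 hc
    refine h6.not_ge ?_
    have : 1 / c = (1 / c + 1 + u ^ 2 + u) - (1 + u ^ 2 + u) := by ring
    rw [this]
    refine 𝔭.valuation.map_sub_le hu (𝔭.valuation.map_add_le (𝔭.valuation.map_add_le
      (map_one _).le ?_) hle)
    rw [map_pow]
    exact pow_le_one₀ zero_le hle
  have hu0 : u ≠ 0 := by
    rintro rfl
    simp at hu1
  have huL : algebraMap K L u ≠ 0 := by simpa using hu0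
  have hui : 𝔭.valuation u⁻¹ < 1 := by
    rw [map_inv₀]
    exact inv_lt_one_of_one_lt₀ hu1
  set D := 1 / c + 1 + u ^ 2 + u with hD
  have hDL : algebraMap K L D = 1 / (t ^ 2 * (1 + t)) + 1 + algebraMap K L u ^ 2 +
      algebraMap K L u := by
    simp [hD, ht']
  have hz : (1 / t + algebraMap K L u) ^ 2 + (1 / t + algebraMap K L u) =
      algebraMap K L D + t / (1 + t) := by
    rw [hDL]
    field_simp
    linear_combination ((1 + t) * algebraMap K L u * t - t ^ 3 + t) * h2'
  have hz1 : 𝔓.valuation (1 / t + algebraMap K L u) ≤ 1 := by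
    refine 𝔓.valuation_le_one_of_sq_add_self hz ?_
    refine 𝔓.valuation.map_add_le (h.valuation_le_one hu) ?_
    rw [map_div₀, h4, div_one]
    exact ht1.le
  have hgen' : Algebra.adjoin K {1 / t + algebraMap K L u} = ⊤ := by
    refine Algebra.adjoin_singleton_eq_top_of_mem hgen ?_
    have := inv_mem (sub_mem
      (IntermediateField.mem_adjoin_simple_self K (1 / t + algebraMap K L u))
      (IntermediateField.algebraMap_mem _ u))
    have hinv : (1 / t + algebraMap K L u - algebraMap K L u)⁻¹ = t := by
      rw [add_sub_cancel_right, one_div, inv_inv]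
    rwa [hinv] at this
  have hD1 : 𝔭.valuation (u⁻¹ * (D + 1)) < 1 := by
    rw [map_mul]
    exact mul_lt_one_of_lt_of_le hui (𝔭.valuation.map_add_le hu (map_one _).le)
  -- For `z = 1/t + u`, the error `t/(1 + t)` is `1/(z + u + 1)`. Expanding `(z² + z - D)(z + u + 1)
  -- = 1` and dividing by `u` gives this cubic, which reduces to `X² + X + D` with derivative 1.
  refine h.eq_one_of_cubic hgen' hz1 (a₃ := u⁻¹) (a₂ := 1) (a₁ := u⁻¹ * (D + 1) + 1)
    (a₀ := D + u⁻¹ * (D + 1)) hui.le (by simp) (𝔭.valuation.map_add_le hD1.le (map_one _).le)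
    (𝔭.valuation.map_add_le hu hD1.le) ?_ ?_
  · simp only [map_add, map_mul, map_inv₀, map_one, hDL]
    field_simp
    generalize algebraMap K L u = U
    linear_combination (2 * U ^ 3 * t ^ 4 + 2 * U ^ 3 * t ^ 3 + 2 * U ^ 2 * t ^ 4 +
      5 * U ^ 2 * t ^ 3 + 3 * U ^ 2 * t ^ 2 + 2 * U * t ^ 4 + 3 * U * t ^ 3 + 3 * U * t ^ 2 +
      3 * U * t + t ^ 4 + 2 * t ^ 3 + t ^ 2 + t + 1) * h2'
  · rw [map_add (algebraMap K L) _ 1, map_one, h2', mul_one, zero_mul, add_zero, ← add_assoc,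
      Valuation.map_add_eq_of_lt_right _ _, map_one]
    rw [map_one]
    refine 𝔓.valuation.map_add_lt ?_ (h.valuation_lt_one hD1)
    rw [map_mul, map_mul]
    refine mul_lt_one_of_lt_of_le
      (mul_lt_one_of_nonneg_of_lt_one_right ?_ zero_le (h.valuation_lt_one hui)) ?_
    · exact (3 : 𝔓.valuation.valuationSubring).2
    · rw [map_pow]
      exact pow_le_one₀ zero_le hz1

/-- The minimal polynomial of `t⁻¹` has constant term `1 / c`, which is not integral. Through
`exists_above` this produces a place where `t` vanishes. -/
theorem not_isIntegral_inv_of_split (hgen : IntermediateField.adjoin K {t} = ⊤)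
    (hfin : Module.finrank K L = 3) (ht : t ^ 2 * (3 - t) = algebraMap K L c)
    (hc : 𝔭.valuation c < 1) (hc0 : c ≠ 0) : ¬ IsIntegral 𝔭.valuation.valuationSubring t⁻¹ := by
  intro hint
  have : FiniteDimensional K L := Module.finite_of_finrank_eq_succ hfin
  have hcL : algebraMap K L c ≠ 0 := by simpa using hc0
  have ht0 : t ≠ 0 := by
    rintro rfl
    exact hcL (by rw [← ht]; simp)
  have hgen' : IntermediateField.adjoin K {t⁻¹} = ⊤ := by
    refine top_unique ?_
    rw [← hgen, IntermediateField.adjoin_simple_le_iff, ← inv_mem_iff]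
    exact IntermediateField.mem_adjoin_simple_self K t⁻¹
  have hdeg : (minpoly K t⁻¹).natDegree = 3 := by
    rw [← IntermediateField.adjoin.finrank (Algebra.IsIntegral.isIntegral t⁻¹), hgen',
      IntermediateField.finrank_top', hfin]
  let F : K[X] := X ^ 3 + C (-3 / c) * X + C (1 / c)
  have hFm : F.Monic := by unfold F; monicity!
  have hFd : F.natDegree = 3 := by unfold F; compute_degree!
  have hF0 : aeval t⁻¹ F = 0 := by
    simp only [F, map_add, map_mul, map_pow, aeval_X, aeval_C, map_div₀, map_neg, map_ofNat,
      map_one, ← ht]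
    rw [← ht] at hcL
    have h3t : 3 - t ≠ 0 := right_ne_zero_of_mul hcL
    field_simp
    ring
  have hF : F = minpoly K t⁻¹ := eq_of_monic_of_dvd_of_natDegree_le
    (minpoly.monic (Algebra.IsIntegral.isIntegral t⁻¹)) hFm (minpoly.dvd K _ hF0)
    (by rw [hFd, hdeg])
  rw [minpoly.isIntegrallyClosed_eq_field_fractions' K hint] at hF
  have h0 := congrArg (fun q => q.coeff 0) hF
  simp [F] at h0
  have h1 := ((minpoly 𝔭.valuation.valuationSubring t⁻¹).coeff 0).2
  rw [← h0] at h1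
  change 𝔭.valuation c⁻¹ ≤ 1 at h1
  rw [map_inv₀] at h1
  exact h1.not_gt ((one_lt_inv₀ (zero_lt_iff.2 (𝔭.valuation_ne_zero hc0))).2 hc)

end Split

end HasRamificationIndex

end Place

namespace Place

section Valuations

variable {K : Type*} [Field K] (𝔭 : Place K)

theorem valuation_intCast_le_one (n : ℤ) : 𝔭.valuation (n : K) ≤ 1 :=
  (n : 𝔭.valuation.valuationSubring).2

theorem modEq_iff {a b : K} (hb : 𝔭.valuation b ≤ 1) :
    𝔭.ModEq a b ↔ 𝔭.valuation (a - b) < 1 := by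
  refine ⟨fun h => h.2.2, fun h => ⟨?_, hb, h⟩⟩
  rw [← sub_add_cancel a b]
  exact 𝔭.valuation.map_add_le h.le hb

theorem modEq_two_iff {a : K} : 𝔭.ModEq a 2 ↔ 𝔭.valuation (a - 2) < 1 :=
  𝔭.modEq_iff (mod_cast 𝔭.valuation_intCast_le_one 2)

theorem modEq_neg_two_iff {a : K} : 𝔭.ModEq a (-2) ↔ 𝔭.valuation (a + 2) < 1 := by
  rw [𝔭.modEq_iff (mod_cast 𝔭.valuation_intCast_le_one (-2)), sub_neg_eq_add]

/-- The sum `1 / a + 1 + w ^ 2 - w` has a pole of odd order at the place for some `w`. -/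
def HasOddPole (a : K) : Prop :=
  ∃ w : K, 𝔭.ord (1 / a + 1 + w ^ 2 - w) < 0 ∧ ¬ (2 : ℤ) ∣ 𝔭.ord (1 / a + 1 + w ^ 2 - w)

end Valuations

/-! ### Ramification in the quadratic resolvent extension. -/

section Resolvent

variable {K M : Type*} [Field K] [Field M] [Algebra K M] (𝔭 : Place K)
  {g : M} {a : K}

theorem isSeparable_of_resolvent (hgen : IntermediateField.adjoin K {g} = ⊤)
    (hg : aeval g (quadraticResolvent a) = 0) (h3 : (3 : K) ≠ 0) (ha : a ^ 2 - 4 ≠ 0) :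
    Algebra.IsSeparable K M := by
  refine Algebra.isSeparable_of_adjoin_eq_top hgen
    ((Polynomial.separable_X_sq_add ?_).of_dvd (minpoly.dvd K g hg))
  have : (3 * a) ^ 2 - 4 * (-27 + 9 * a ^ 2) = -(3 ^ 3 * (a ^ 2 - 4)) := by ring
  rw [this]
  exact neg_ne_zero.2 (mul_ne_zero (pow_ne_zero 3 h3) ha)

/-- Completing the square: `(2g + 3a)² = -27(a² - 4)`, and -27 is a unit. -/
theorem isRamifiedIn_resolvent_iff [FiniteDimensional K M]
    (hgen : IntermediateField.adjoin K {g} = ⊤)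
    (hg : aeval g (quadraticResolvent a) = 0) (h3 : 𝔭.valuation 3 = 1) (h2 : 𝔭.valuation 2 = 1)
    (ha : a ^ 2 - 4 ≠ 0) : 𝔭.IsRamifiedIn M ↔ ¬ (2 : ℤ) ∣ 𝔭.ord (a ^ 2 - 4) := by
  have h30 : (3 : K) ≠ 0 := by
    intro h0
    rw [h0, map_zero] at h3
    exact zero_ne_one h3
  have h20 : (2 : K) ≠ 0 := by
    intro h0
    rw [h0, map_zero] at h2
    exact zero_ne_one h2
  have h2M : (2 : M) ≠ 0 := by
    rw [← map_ofNat (algebraMap K M) 2]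
    simpa using h20
  have := isSeparable_of_resolvent hgen hg h30 ha
  set d := -(3 ^ 3 * (a ^ 2 - 4)) with hd
  have hd0 : d ≠ 0 := neg_ne_zero.2 (mul_ne_zero (pow_ne_zero 3 h30) ha)
  have hord : 𝔭.ord d = 𝔭.ord (a ^ 2 - 4) := ord_eq_of_valuation_eq_valuation _ (by
    rw [hd, Valuation.map_neg, map_mul, map_pow, h3, one_pow, one_mul])
  set ρ := 2 * g + algebraMap K M (3 * a) with hρ
  have hρ2 : ρ ^ 2 = algebraMap K M d := by
    simp [quadraticResolvent] at hg
    simp only [hρ, hd, map_neg, map_mul, map_pow, map_sub, map_ofNat] at hg ⊢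
    linear_combination 4 * hg
  have hgen' : Algebra.adjoin K {ρ} = ⊤ := by
    refine Algebra.adjoin_singleton_eq_top_of_mem hgen ?_
    have hm := mul_mem (sub_mem (IntermediateField.mem_adjoin_simple_self K ρ)
      (IntermediateField.algebraMap_mem _ (3 * a))) (IntermediateField.algebraMap_mem _ (2⁻¹ : K))
    have : (ρ - algebraMap K M (3 * a)) * algebraMap K M 2⁻¹ = g := by
      rw [hρ, add_sub_cancel_right, map_inv₀, map_ofNat]
      field_simp
    rwa [this] at hm
  rw [← hord]
  constructor
  · rintro ⟨𝔓, e, h, he⟩ heven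
    rw [h.eq_one_of_sq h2 hgen' hd0 hρ2 heven] at he
    exact lt_irrefl _ he
  · intro hodd
    obtain ⟨𝔓, e, h⟩ := 𝔭.exists_above_self (L := M)
    have := Nat.le_of_dvd h.1 (h.two_dvd_of_sq hd0 hρ2 hodd)
    exact ⟨𝔓, e, h, by omega⟩

/-- In characteristic 2, `(g + 1) / a` is a root of `X² + X = 1/a + 1`; Artin–Schreier reduction
leaves either an odd pole or an unramified equation. -/
theorem isRamifiedIn_resolvent_iff_of_char_two (k : Type*) [Field k] [Finite k]
    [Algebra (RatFunc k) K] [FunctionField k K] [CharP K 2]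
    [FiniteDimensional K M] (hgen : IntermediateField.adjoin K {g} = ⊤)
    (hg : aeval g (quadraticResolvent a) = 0) (ha : a ≠ 0) :
    𝔭.IsRamifiedIn M ↔ 𝔭.HasOddPole a := by
  have h2 : (2 : K) = 0 := CharP.cast_eq_zero K 2
  have h2M : (2 : M) = 0 := by rw [← map_ofNat (algebraMap K M) 2, h2, map_zero]
  have haM : algebraMap K M a ≠ 0 := by simpa using ha
  have := isSeparable_of_resolvent hgen hg
    (by rw [show (3 : K) = 1 by linear_combination h2]; exact one_ne_zero)
    (by rw [show a ^ 2 - 4 = a ^ 2 by linear_combination (-2) * h2]; exact pow_ne_zero 2 ha)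
  simp only [quadraticResolvent, map_add, map_mul, map_pow, aeval_X, aeval_C, map_neg,
    map_ofNat] at hg
  have hσ : ∀ u : K, ((g + 1) / algebraMap K M a + algebraMap K M u) ^ 2 +
      ((g + 1) / algebraMap K M a + algebraMap K M u) =
      algebraMap K M (1 / a + 1 + u ^ 2 - u) := by
    intro u
    simp only [map_add, map_sub, map_div₀, map_one, map_pow]
    field_simp
    generalize algebraMap K M a = b at *
    generalize algebraMap K M u = v
    linear_combination hg + (14 - b * g - 5 * b ^ 2 + b ^ 2 * v + g + b * v + g * b * v) * h2M
  constructor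
  · rintro ⟨𝔓, e, h, he⟩
    by_contra hno
    obtain ⟨u, hu⟩ := 𝔭.exists_artinSchreier_reduced (k := k) (1 / a + 1)
    rw [show 1 / a + 1 + u ^ 2 + u = 1 / a + 1 + u ^ 2 - u by linear_combination u * h2] at hu
    have hgen' : Algebra.adjoin K {(g + 1) / algebraMap K M a + algebraMap K M u} = ⊤ := by
      refine Algebra.adjoin_singleton_eq_top_of_mem hgen ?_
      have hm := sub_mem (mul_mem (sub_mem
        (IntermediateField.mem_adjoin_simple_self K
          ((g + 1) / algebraMap K M a + algebraMap K M u))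
        (IntermediateField.algebraMap_mem _ u)) (IntermediateField.algebraMap_mem _ a)) (one_mem _)
      have hgm : ((g + 1) / algebraMap K M a + algebraMap K M u - algebraMap K M u) *
          algebraMap K M a - 1 = g := by
        field_simp
        ring
      rwa [hgm] at hm
    rcases hu with hu | hu
    · rw [h.eq_one_of_artinSchreier h2 hgen' (hσ u) hu] at he
      exact lt_irrefl _ he
    · exact hno ⟨u, hu⟩
  · rintro ⟨u, hu, hodd⟩
    obtain ⟨𝔓, e, h⟩ := 𝔭.exists_above_self (L := M)
    have := Nat.le_of_dvd h.1 (h.two_dvd_of_artinSchreier (ε := 0)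
      ((hσ u).trans (add_zero _).symm) (by simp) hu hodd)
    exact ⟨𝔓, e, h, by omega⟩

end Resolvent

/-! ### The cubic at places with `a ≡ 2`. -/

section Cubic

variable {K L : Type*} [Field K] [Field L] [Algebra K L] (𝔭 : Place K)

/-- This isolates the argument common to both characteristics, `Q` being the criterion. A ramified
place must have `t` vanishing, hence `Q` and `2 ∣ e`, which excludes 3. Conversely, `Q` at a place
where `t` vanishes gives `2 ∣ e ≤ 3`, so `e = 2`. -/
theorem isPartiallyRamifiedIn_iff_of_split [Algebra.IsSeparable K L] {t : L} {c : K}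
    (hfin : Module.finrank K L = 3) (hgen : IntermediateField.adjoin K {t} = ⊤)
    (ht : t ^ 2 * (3 - t) = algebraMap K L c) (h3 : 𝔭.valuation 3 = 1) (hc : 𝔭.valuation c < 1)
    (hc0 : c ≠ 0) {Q : Prop}
    (hQ : ∀ (𝔓 : Place L) (e : ℕ), 𝔓.HasRamificationIndex 𝔭 e → 𝔓.valuation t < 1 → Q → 2 ∣ e)
    (hQ' : ∀ (𝔓 : Place L) (e : ℕ), 𝔓.HasRamificationIndex 𝔭 e → 𝔓.valuation t < 1 → ¬ Q →
      e = 1) :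
    (𝔭.IsPartiallyRamifiedIn L ↔ Q) ∧ ¬ 𝔭.IsFullyRamifiedIn L := by
  have : FiniteDimensional K L := Module.finite_of_finrank_eq_succ hfin
  have hint := HasRamificationIndex.isIntegral_of_split ht h3 hc
  have key : ∀ (𝔓 : Place L) (e : ℕ), 𝔓.HasRamificationIndex 𝔭 e → e ≠ 1 → Q ∧ 2 ∣ e := by
    intro 𝔓 e h he
    have ht1 : 𝔓.valuation t < 1 := lt_of_le_of_ne (valuation_le_one_of_isIntegral h hint)
      fun h1 => he (h.eq_one_of_split_unit hgen ht h3 hc h1)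
    have hq : Q := not_not.1 fun hq => he (hQ' 𝔓 e h ht1 hq)
    exact ⟨hq, hQ 𝔓 e h ht1 hq⟩
  refine ⟨⟨fun ⟨𝔓, h⟩ => (key 𝔓 2 h (by norm_num)).1, fun hq => ?_⟩, fun ⟨𝔓, h⟩ => ?_⟩
  · obtain ⟨𝔓, e, h, ht1⟩ := 𝔭.exists_above hint
      (HasRamificationIndex.not_isIntegral_inv_of_split hgen hfin ht hc hc0)
    have h1 := h.le_finrank
    have h2 := hQ 𝔓 e h ht1 hq
    have h4 := h.1
    rw [hfin] at h1
    have : e = 2 := by omega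
    exact ⟨𝔓, this ▸ h⟩
  · rw [hfin] at h
    have := (key 𝔓 3 h (by norm_num)).2
    omega

variable {y : L} {a : K}

theorem isPartiallyRamifiedIn_iff_of_valuation_sub_two_lt_one (k : Type*) [Field k] [Finite k]
    [Algebra (RatFunc k) K] [FunctionField k K] [Algebra.IsSeparable K L]
    (hfin : Module.finrank K L = 3) (hgen : IntermediateField.adjoin K {y} = ⊤)
    (hy : y ^ 3 - 3 * y = algebraMap K L a) (h3 : 𝔭.valuation 3 = 1) (ha0 : a ≠ 2)
    (ha : 𝔭.valuation (a - 2) < 1) :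
    (𝔭.valuation 2 = 1 → (𝔭.IsPartiallyRamifiedIn L ↔ ¬ (2 : ℤ) ∣ 𝔭.ord (a ^ 2 - 4))) ∧
    (CharP K 2 → (𝔭.IsPartiallyRamifiedIn L ↔ 𝔭.HasOddPole a)) ∧
    (𝔭.valuation 2 = 1 ∨ CharP K 2 → ¬ 𝔭.IsFullyRamifiedIn L) := by
  have : FiniteDimensional K L := Module.finite_of_finrank_eq_succ hfin
  have hc0 : 2 - a ≠ 0 := sub_ne_zero.2 ha0.symm
  have hc : 𝔭.valuation (2 - a) < 1 := by rwa [Valuation.map_sub_swap]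
  have ht : (y + 1) ^ 2 * (3 - (y + 1)) = algebraMap K L (2 - a) := by
    rw [map_sub, map_ofNat, ← hy]
    ring
  have hgen' : IntermediateField.adjoin K {y + 1} = ⊤ := by
    refine top_unique ?_
    rw [← hgen, IntermediateField.adjoin_simple_le_iff]
    simpa using sub_mem (IntermediateField.mem_adjoin_simple_self K (y + 1)) (one_mem _)
  have odd : 𝔭.valuation 2 = 1 →
      (𝔭.IsPartiallyRamifiedIn L ↔ ¬ (2 : ℤ) ∣ 𝔭.ord (a ^ 2 - 4)) ∧ ¬ 𝔭.IsFullyRamifiedIn L := by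
    intro h2
    have hord : 𝔭.ord (a ^ 2 - 4) = 𝔭.ord (2 - a) := by
      refine ord_eq_of_valuation_eq_valuation _ ?_
      have h4 : 𝔭.valuation (2 * 2 - (2 - a)) = 1 := by
        have h22 : 𝔭.valuation (2 * 2) = 1 := by rw [map_mul, h2, one_mul]
        rw [Valuation.map_sub_eq_of_lt_left _ (by rwa [h22]), h22]
      rw [show a ^ 2 - 4 = -((2 - a) * (2 * 2 - (2 - a))) by ring, Valuation.map_neg, map_mul, h4,
        mul_one]
    rw [hord]
    exact 𝔭.isPartiallyRamifiedIn_iff_of_split hfin hgen' ht h3 hc hc0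
      (fun 𝔓 e h ht1 hq => h.two_dvd_of_split ht h3 hc0 ht1 hq)
      (fun 𝔓 e h ht1 hq => h.eq_one_of_split hgen' ht h3 h2 hc hc0 ht1 (not_not.1 hq))
  have even : CharP K 2 →
      (𝔭.IsPartiallyRamifiedIn L ↔ 𝔭.HasOddPole a) ∧ ¬ 𝔭.IsFullyRamifiedIn L := by
    intro hchar
    have h2 : (2 : K) = 0 := CharP.cast_eq_zero K 2
    have hca : 2 - a = a := by linear_combination (1 - a) * h2
    rw [hca] at ht hc hc0
    have hpm : ∀ u : K, 1 / a + 1 + u ^ 2 + u = 1 / a + 1 + u ^ 2 - u := fun u => by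
      linear_combination u * h2
    refine 𝔭.isPartiallyRamifiedIn_iff_of_split hfin hgen' ht h3 hc hc0
      (fun 𝔓 e h ht1 ⟨u, hu, hodd⟩ => ?_) (fun 𝔓 e h ht1 hq => ?_)
    · rw [← hpm] at hu hodd
      exact h.two_dvd_of_split_char_two ht h2 hc0 ht1 hu hodd
    · obtain ⟨u, hu | hu⟩ := 𝔭.exists_artinSchreier_reduced (k := k) (1 / a + 1)
      · exact h.eq_one_of_split_char_two hgen' ht h2 hc hc0 ht1 hu
      · rw [hpm] at hu
        exact absurd ⟨u, hu⟩ hq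
  exact ⟨fun h => (odd h).1, fun h => (even h).1, fun h => h.elim (fun h => (odd h).2)
    fun h => (even h).2⟩

end Cubic

end Place

/-! ### Assembly of the cases. -/

theorem mainTheorem5 {k K L : Type*} [Field k] [Finite k] [Field K] [Algebra (RatFunc k) K]
    [FunctionField k K] [Field L] [Algebra K L] (p : ℕ) [CharP K p] (hp : p ≠ 3)
    (hL : IsImpurelyCubic K L) (y : L) (hy : IntermediateField.adjoin K {y} = ⊤)
    (a : K) (hmin : minpoly K y = X ^ 3 - C 3 * X - C a) (𝔭 : Place K) :
    (𝔭.IsFullyRamifiedIn L ↔ 𝔭.ord a < 0 ∧ Int.gcd (𝔭.ord a) 3 = 1) ∧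
    (∀ r : AlgebraicClosure K, aeval r (quadraticResolvent a) = 0 →
      (𝔭.IsPartiallyRamifiedIn L ↔
        (𝔭.ModEq a 2 ∨ 𝔭.ModEq a (-2)) ∧ 𝔭.IsRamifiedIn (IntermediateField.adjoin K {r}))) ∧
    (p ≠ 2 →
      (𝔭.IsPartiallyRamifiedIn L ↔
        (𝔭.ModEq a 2 ∨ 𝔭.ModEq a (-2)) ∧ Int.gcd (𝔭.ord (a ^ 2 - 4)) 2 = 1)) ∧
    (p = 2 →
      (𝔭.IsPartiallyRamifiedIn L ↔
        (𝔭.ModEq a 2 ∨ 𝔭.ModEq a (-2)) ∧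
        ∃ w : K, 𝔭.ord (1 / a + 1 + w ^ 2 - w) < 0 ∧
          Int.gcd (𝔭.ord (1 / a + 1 + w ^ 2 - w)) 2 = 1)) := by
  have hfin := hL.1
  have hfd : FiniteDimensional K L := Module.finite_of_finrank_eq_succ hfin
  have hyint : IsIntegral K y := Algebra.IsIntegral.isIntegral y
  have hcast : ∀ {n : ℕ}, (n : K) ≠ 0 → 𝔭.valuation (n : K) = 1 :=
    𝔭.valuation_natCast_eq_one ((algebraMap (RatFunc k) K).comp (algebraMap k (RatFunc k)))
  have h30 : (3 : K) ≠ 0 := by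
    intro h0
    have := (CharP.cast_eq_zero_iff K p 3).1 (mod_cast h0)
    rcases (Nat.dvd_prime Nat.prime_three).1 this with h1 | h1
    · exact CharP.char_ne_one K p h1
    · exact hp h1
  have h3 : 𝔭.valuation 3 = 1 := mod_cast hcast (n := 3) (mod_cast h30)
  have hchar2 : p = 2 → CharP K 2 := fun h => h ▸ ‹CharP K p›
  have h2 : p ≠ 2 → 𝔭.valuation 2 = 1 := by
    intro hp2
    refine mod_cast hcast (n := 2) fun h0 => ?_
    rcases (Nat.dvd_prime Nat.prime_two).1 ((CharP.cast_eq_zero_iff K p 2).1 h0) with h1 | h1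
    · exact CharP.char_ne_one K p h1
    · exact hp2 h1
  have hya : y ^ 3 - 3 * y = algebraMap K L a := by
    have := minpoly.aeval K y
    rw [hmin] at this
    simp only [map_sub, map_mul, aeval_X_pow, aeval_X, aeval_C, map_ofNat] at this
    linear_combination this
  have hroot : ∀ z : K, z ^ 3 - 3 * z - a ≠ 0 := by
    intro z hz
    have hdeg := Polynomial.degree_eq_one_of_irreducible_of_root (minpoly.irreducible hyint)
      (x := z) (by rw [hmin]; simpa using hz)
    have hnat := natDegree_eq_of_degree_eq_some hdeg
    rw [← IntermediateField.adjoin.finrank hyint, hy, IntermediateField.finrank_top', hfin] at hnat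
    norm_num at hnat
  -- For `a = 2, -2, 0` the cubic would have the root `2, -2, 0` in `K`.
  have ha2 : a ≠ 2 := fun h => hroot 2 (by rw [h]; ring)
  have ha2' : -a ≠ 2 := fun h => hroot (-2) (by linear_combination h)
  have ha4 : a ^ 2 - 4 ≠ 0 := by
    rw [show a ^ 2 - 4 = (a - 2) * -(-a - 2) by ring]
    exact mul_ne_zero (sub_ne_zero.2 ha2) (neg_ne_zero.2 (sub_ne_zero.2 ha2'))
  have ha0 : a ≠ 0 := fun h => hroot 0 (by rw [h]; ring)
  have hsep : Algebra.IsSeparable K L := by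
    refine Algebra.isSeparable_of_adjoin_eq_top hy ?_
    refine (Polynomial.separable_iff_derivative_ne_zero (minpoly.irreducible hyint)).2 fun h0 => ?_
    -- The derivative `3X² - 3` has leading coefficient 3, nonzero in `K`.
    have := congrArg (fun q => q.coeff 2) h0
    rw [hmin] at this
    refine h30 (Eq.trans ?_ this)
    rw [coeff_derivative]
    simp
    norm_num
  have hfull3 : 𝔭.ord a < 0 → ¬ (3 : ℤ) ∣ 𝔭.ord a → 𝔭.IsFullyRamifiedIn L := by
    intro hneg hndvd
    obtain ⟨𝔓, e, h⟩ := 𝔭.exists_above_self (L := L)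
    have h1 := h.three_dvd_of_pole hya h3 hneg hndvd
    have h4 := h.le_finrank
    have h5 := h.1
    refine ⟨𝔓, ?_⟩
    rw [hfin] at h4 ⊢
    have : e = 3 := by omega
    exact this ▸ h
  have hunram : ¬ 𝔭.valuation (a - 2) < 1 → ¬ 𝔭.valuation (a + 2) < 1 →
      𝔭.ord a < 0 ∧ ¬ (3 : ℤ) ∣ 𝔭.ord a ∨ ∀ (𝔓 : Place L) (e : ℕ), 𝔓.HasRamificationIndex 𝔭 e →
        e = 1 := by
    intro hm hp
    by_cases hneg : 𝔭.ord a < 0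
    · by_cases hdvd : (3 : ℤ) ∣ 𝔭.ord a
      · exact Or.inr fun 𝔓 e h => h.eq_one_of_pole hy hya h3 hneg hdvd
      · exact Or.inl ⟨hneg, hdvd⟩
    · have ha1 := (𝔭.valuation_le_one_iff ha0).2 (not_lt.1 hneg)
      have h2i : 𝔭.valuation (2 : K) ≤ 1 := mod_cast 𝔭.valuation_intCast_le_one 2
      exact Or.inr fun 𝔓 e h => h.eq_one_of_not_modEq hy hya h3 ha1
        (le_antisymm (𝔭.valuation.map_sub_le ha1 h2i) (not_lt.1 hm))
        (le_antisymm (𝔭.valuation.map_add_le ha1 h2i) (not_lt.1 hp))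
  have hsplit : 𝔭.valuation (a - 2) < 1 ∨ 𝔭.valuation (a + 2) < 1 →
      (p ≠ 2 → (𝔭.IsPartiallyRamifiedIn L ↔ ¬ (2 : ℤ) ∣ 𝔭.ord (a ^ 2 - 4))) ∧
      (p = 2 → (𝔭.IsPartiallyRamifiedIn L ↔ 𝔭.HasOddPole a)) ∧ ¬ 𝔭.IsFullyRamifiedIn L := by
    have h2' : 𝔭.valuation 2 = 1 ∨ CharP K 2 := by
      by_cases hp2 : p = 2
      · exact Or.inr (hchar2 hp2)
      · exact Or.inl (h2 hp2)
    rintro (hm | hm)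
    · obtain ⟨h4, h5, h6⟩ := 𝔭.isPartiallyRamifiedIn_iff_of_valuation_sub_two_lt_one k hfin hy hya
        h3 ha2 hm
      exact ⟨fun h => h4 (h2 h), fun h => h5 (hchar2 h), h6 h2'⟩
    -- The pair `(-y, -a)` satisfies the same equation and turns `a ≡ -2` into `-a ≡ 2`. The
    -- criteria are unchanged: `a²` is even in `a`, and `-a = a` in characteristic 2.
    · have hgen : IntermediateField.adjoin K {-y} = ⊤ := by
        refine top_unique ?_
        rw [← hy, IntermediateField.adjoin_simple_le_iff, ← neg_mem_iff]
        exact IntermediateField.mem_adjoin_simple_self K (-y)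
      obtain ⟨h4, h5, h6⟩ := 𝔭.isPartiallyRamifiedIn_iff_of_valuation_sub_two_lt_one k hfin hgen
        (a := -a) (by rw [map_neg, ← hya]; ring) h3 ha2'
        (by rwa [← neg_add', Valuation.map_neg])
      refine ⟨fun h => ?_, fun h => ?_, h6 h2'⟩
      · rw [← neg_sq a]
        exact h4 (h2 h)
      · have := hchar2 h
        have hna : -a = a := by
          linear_combination -a * (CharP.cast_eq_zero K 2 : ((2 : ℕ) : K) = 0)
        rw [← hna]
        exact h5 this
  have hpart : ¬ (𝔭.valuation (a - 2) < 1 ∨ 𝔭.valuation (a + 2) < 1) →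
      ¬ 𝔭.IsPartiallyRamifiedIn L := by
    rintro hno ⟨𝔓, h⟩
    rw [not_or] at hno
    rcases hunram hno.1 hno.2 with h1 | h1
    · have := h.three_dvd_of_pole hya h3 h1.1 h1.2
      omega
    · exact absurd (h1 𝔓 2 h) (by norm_num)
  have gcd3 : ∀ x : ℤ, Int.gcd x 3 = 1 ↔ ¬ (3 : ℤ) ∣ x :=
    Int.gcd_eq_one_iff_not_dvd Nat.prime_three
  have gcd2 : ∀ x : ℤ, Int.gcd x 2 = 1 ↔ ¬ (2 : ℤ) ∣ x :=
    Int.gcd_eq_one_iff_not_dvd Nat.prime_two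
  simp only [gcd2, gcd3, Place.modEq_two_iff, Place.modEq_neg_two_iff]
  have hodd : p ≠ 2 → (𝔭.IsPartiallyRamifiedIn L ↔
      (𝔭.valuation (a - 2) < 1 ∨ 𝔭.valuation (a + 2) < 1) ∧ ¬ (2 : ℤ) ∣ 𝔭.ord (a ^ 2 - 4)) := by
    intro hp2
    by_cases hs : 𝔭.valuation (a - 2) < 1 ∨ 𝔭.valuation (a + 2) < 1
    · rw [(hsplit hs).1 hp2, and_iff_right hs]
    · exact iff_of_false (hpart hs) fun h => hs h.1
  have heven : p = 2 → (𝔭.IsPartiallyRamifiedIn L ↔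
      (𝔭.valuation (a - 2) < 1 ∨ 𝔭.valuation (a + 2) < 1) ∧ 𝔭.HasOddPole a) := by
    intro hp2
    by_cases hs : 𝔭.valuation (a - 2) < 1 ∨ 𝔭.valuation (a + 2) < 1
    · rw [(hsplit hs).2.1 hp2, and_iff_right hs]
    · exact iff_of_false (hpart hs) fun h => hs h.1
  refine ⟨⟨fun hf => ?_, fun h => hfull3 h.1 h.2⟩, fun r hr => ?_, hodd, heven⟩
  · by_cases hs : 𝔭.valuation (a - 2) < 1 ∨ 𝔭.valuation (a + 2) < 1
    · exact absurd hf (hsplit hs).2.2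
    · rw [not_or] at hs
      refine (hunram hs.1 hs.2).resolve_right fun h1 => ?_
      obtain ⟨𝔓, h⟩ := hf
      have := h1 𝔓 _ h
      omega
  · have hrint : IsIntegral K r := Algebra.IsIntegral.isIntegral r
    have := IntermediateField.adjoin.finiteDimensional hrint
    have hgen : IntermediateField.adjoin K {IntermediateField.AdjoinSimple.gen K r} = ⊤ := by
      have h1 := (IntermediateField.adjoin.powerBasis hrint).adjoin_gen_eq_top
      rw [IntermediateField.adjoin.powerBasis_gen] at h1
      exact IntermediateField.adjoin_eq_top_of_algebra K _ h1
    have hg : aeval (IntermediateField.AdjoinSimple.gen K r) (quadraticResolvent a) = 0 := by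
      refine (algebraMap (IntermediateField.adjoin K {r}) (AlgebraicClosure K)).injective ?_
      rw [← aeval_algebraMap_apply, IntermediateField.AdjoinSimple.algebraMap_gen, hr, map_zero]
    by_cases hp2 : p = 2
    · have := hchar2 hp2
      rw [𝔭.isRamifiedIn_resolvent_iff_of_char_two k hgen hg ha0]
      exact heven hp2
    · rw [𝔭.isRamifiedIn_resolvent_iff hgen hg h3 (h2 hp2) ha4]
      exact hodd hp2
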